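/- Let $n\in\mathbb N$, $T>0$, let $\rho_0,\theta\in\mathbb C^{n\times n}$ be Hermitian and let $H_1\in\mathfrak{su}(n)$ (traceless skew-Hermitian matrices). Let $\mathcal H=L^2([0,T],\mathbb R)$ with $(u,v)_{\mathcal H}=\int_0^T uv\,dt$. For $H_0\in\mathfrak{su}(n)$ and $u\in\mathcal H$, let $\rho$ be the (Carathéodory) solution on $[0,T]$ of $$\dot\rho(t)=[H_0+u(t)H_1,\rho(t)],\qquad \rho(0)=\rho_0,$$ and put $\mathrm{End}(u):=\rho(T)$, a point of the orbit $\mathcal O(\rho_0)=\{U\rho_0U^\dagger: U\in SU(n)\}$. Equip $T_\rho\mathcal O(\rho_0)=\{[\rho,\Omega]:\Omega\in\mathfrak{su}(n)\}$ with the metric $\langle[\rho,\Omega_1],[\rho,\Omega_2]\rangle_\rho=\mathrm{tr}\big((\Omega_1^{\mathfrak p})^\dagger\Omega_2^{\mathfrak p}\big)$, where $\Omega^{\mathfrak p}$ is the component of $\Omega$ orthogonal, for the product $\mathrm{tr}(A^\dagger B)$ on $\mathfrak{su}(n)$, to $\{\Omega\in\mathfrak{su}(n):[\rho,\Omega]=0\}$.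 Let $\nabla J$ be the gradient of $J(\rho)=\mathrm{Re}\,\mathrm{tr}(\rho\theta)$ on $\mathcal O(\rho_0)$ for this metric, let $\mathcal J=J\circ\mathrm{End}$, and let $d\mathrm{End}^*(u):T_{\mathrm{End}(u)}\mathcal O(\rho_0)\to\mathcal H$ be the adjoint of the Fréchet differential $d\mathrm{End}(u)$, i.e. $\langle z,d\mathrm{End}(u)v\rangle_{\mathrm{End}(u)}=(d\mathrm{End}^*(u)z,v)_{\mathcal H}$. There is a constant $C$, depending only on $n,\rho_0,\theta,H_1,T$, such that for every $H_0\in\mathfrak{su}(n)$ the following hold. (a) For every $u\in\mathcal H$ these objects are well defined: the equation for $\rho$ has exactly one solution on $[0,T]$, $\mathrm{End}(u)\in\mathcal O(\rho_0)$, $\mathrm{End}$ is Fréchet differentiable at $u$ with $d\mathrm{End}(u)$ taking values in $T_{\mathrm{End}(u)}\mathcal O(\rho_0)$, and $d\mathrm{End}^*(u)$ and $\nabla J(\mathrm{End}(u))$ exist and are unique. Moreover $\mathcal J$ is differentiable at $u$ with $\nabla\mathcal J(u)=d\mathrm{End}^*(u)\,\nabla J(\mathrm{End}(u))$, and $\|\nabla\mathcal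 J(u)\|_{\mathcal H}\le C$. (b) For every $u_0\in\mathcal H$ the initial value problem $$\frac{d\Pi}{ds}(s)=d\mathrm{End}^*(\Pi(s))\,\nabla J(\mathrm{End}(\Pi(s))),\qquad \Pi(0)=u_0,$$ has a solution $\Pi:[0,\infty)\to\mathcal H$ defined for all $s\ge0$, and it is unique: every solution on an interval $I\subseteq[0,\infty)$ containing $0$ coincides with $\Pi$ on $I$. -/

import Mathlib

open MeasureTheory Set
open scoped Matrix Matrix.Norms.Frobenius

noncomputable section

namespace QuantumControl

/-- The space `L²([0,T], ℝ)` of controls, with inner product `(u, v) = ∫₀ᵀ u v`. -/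
abbrev Control (T : ℝ) : Type := Lp ℝ 2 (volume.restrict (Icc (0 : ℝ) T))

/-- Complex `n × n` matrices, carrying the Frobenius (Hilbert-Schmidt) norm. -/
abbrev Mat (n : ℕ) : Type := Matrix (Fin n) (Fin n) ℂ

/-- The real vector space `𝔰𝔲(n)` of traceless skew-Hermitian matrices. -/
def su (n : ℕ) : Submodule ℝ (Mat n) where
  carrier := {A | Aᴴ = -A ∧ A.trace = 0}
  add_mem' := by
    rintro A B ⟨hA, hA'⟩ ⟨hB, hB'⟩
    refine ⟨?_, ?_⟩
    · rw [Matrix.conjTranspose_add, hA, hB, neg_add]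
    · rw [Matrix.trace_add, hA', hB', add_zero]
  zero_mem' := by simp
  smul_mem' := by
    rintro c A ⟨hA, hA'⟩
    refine ⟨?_, ?_⟩
    · rw [Matrix.conjTranspose_smul, hA, star_trivial, smul_neg]
    · rw [Matrix.trace_smul, hA', smul_zero]

/-- The orbit `𝒪(ρ₀) = {U ρ₀ U† : U ∈ SU(n)}`. -/
def unitaryOrbit {n : ℕ} (ρ₀ : Mat n) : Set (Mat n) :=
  {ρ | ∃ U ∈ Matrix.specialUnitaryGroup (Fin n) ℂ, ρ = U * ρ₀ * Uᴴ}

/-- `ad_ρ Ω = [ρ, Ω] = ρ Ω - Ω ρ`, as a real linear map. -/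
def adMap {n : ℕ} (ρ : Mat n) : Mat n →ₗ[ℝ] Mat n :=
  LinearMap.mulLeft ℝ ρ - LinearMap.mulRight ℝ ρ

/-- The tangent space `T_ρ 𝒪(ρ₀) = ad_ρ 𝔰𝔲(n)` of the orbit at its point `ρ`. -/
def tangentSpace {n : ℕ} (ρ : Mat n) : Submodule ℝ (Mat n) := (su n).map (adMap ρ)

/-- The Lie algebra `𝔥_ρ = {Ω ∈ 𝔰𝔲(n) : [ρ, Ω] = 0}` of the stabilizer of `ρ`. -/
def stabAlg {n : ℕ} (ρ : Mat n) : Submodule ℝ (Mat n) := su n ⊓ LinearMap.ker (adMap ρ)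

/-- `𝔭_ρ`: the orthogonal complement of `𝔥_ρ` in `𝔰𝔲(n)` for the Hilbert-Schmidt product
`tr (Ω₁† Ω₂)`.  If `ρ = U ρ₀ U†` with `U ∈ SU(n)`, this is `Ad_U 𝔭_{ρ₀}`
(see `horizontal_conj`). -/
def horizontal {n : ℕ} (ρ : Mat n) : Set (Mat n) :=
  {Ω | Ω ∈ su n ∧ ∀ Ω' ∈ stabAlg ρ, (Ωᴴ * Ω').trace = 0}

/-- `Ad_U` maps `𝔭_ρ` into `𝔭_{Ad_U ρ}`. -/
theorem horizontal_conj_mem {n : ℕ} (ρ U : Mat n)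
    (hU : U ∈ Matrix.specialUnitaryGroup (Fin n) ℂ) {Ω : Mat n} (hΩ : Ω ∈ horizontal ρ) :
    U * Ω * Uᴴ ∈ horizontal (U * ρ * Uᴴ) := by
  have h1 : Uᴴ * U = 1 := Matrix.mem_unitaryGroup_iff'.1 (Matrix.mem_specialUnitaryGroup_iff.1 hU).1
  have h2 : U * Uᴴ = 1 := Matrix.mem_unitaryGroup_iff.1 (Matrix.mem_specialUnitaryGroup_iff.1 hU).1
  obtain ⟨⟨hs, ht⟩, ho⟩ := hΩ
  refine ⟨⟨?_, ?_⟩, ?_⟩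
  · simp [Matrix.conjTranspose_mul, hs, Matrix.mul_assoc]
  · rw [Matrix.trace_mul_comm, ← Matrix.mul_assoc, h1, Matrix.one_mul, ht]
  · rintro Ω' ⟨⟨hs', ht'⟩, hk⟩
    have hk' : U * ρ * Uᴴ * Ω' = Ω' * (U * ρ * Uᴴ) := by
      have : U * ρ * Uᴴ * Ω' - Ω' * (U * ρ * Uᴴ) = 0 := hk
      exact sub_eq_zero.1 this
    have key : Uᴴ * Ω' * U ∈ stabAlg ρ := by
      refine ⟨⟨?_, ?_⟩, ?_⟩
      · simp [Matrix.conjTranspose_mul, hs', Matrix.mul_assoc]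
      · rw [Matrix.trace_mul_comm, ← Matrix.mul_assoc, h2, Matrix.one_mul, ht']
      · have e := congrArg (fun X => Uᴴ * X * U) hk'
        have e1 : Uᴴ * (U * ρ * Uᴴ * Ω') * U = (Uᴴ * U) * (ρ * (Uᴴ * Ω' * U)) := by
          simp only [Matrix.mul_assoc]
        have e2 : Uᴴ * (Ω' * (U * ρ * Uᴴ)) * U = (Uᴴ * Ω' * U * ρ) * (Uᴴ * U) := by
          simp only [Matrix.mul_assoc]
        have e3 : ρ * (Uᴴ * Ω' * U) = (Uᴴ * Ω' * U) * ρ := by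
          simpa only [e1, e2, h1, Matrix.one_mul, Matrix.mul_one] using e
        exact sub_eq_zero.2 e3
    have := ho _ key
    have e : (U * Ω * Uᴴ)ᴴ * Ω' = U * (Ωᴴ * (Uᴴ * Ω')) := by
      simp [Matrix.conjTranspose_mul, Matrix.mul_assoc]
    rw [e, Matrix.trace_mul_comm]
    simpa only [Matrix.mul_assoc] using this

/-- For `U ∈ SU(n)`, `𝔭_{Ad_U ρ} = Ad_U 𝔭_ρ`. -/
theorem horizontal_conj {n : ℕ} (ρ U : Mat n)
    (hU : U ∈ Matrix.specialUnitaryGroup (Fin n) ℂ) :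
    horizontal (U * ρ * Uᴴ) = (fun Ω => U * Ω * Uᴴ) '' horizontal ρ := by
  have h1 : Uᴴ * U = 1 := Matrix.mem_unitaryGroup_iff'.1 (Matrix.mem_specialUnitaryGroup_iff.1 hU).1
  have h2 : U * Uᴴ = 1 := Matrix.mem_unitaryGroup_iff.1 (Matrix.mem_specialUnitaryGroup_iff.1 hU).1
  have hU' : Uᴴ ∈ Matrix.specialUnitaryGroup (Fin n) ℂ := by
    rw [Matrix.mem_specialUnitaryGroup_iff] at hU ⊢
    refine ⟨Matrix.mem_unitaryGroup_iff.2 ?_, ?_⟩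
    · rw [Matrix.star_eq_conjTranspose, Matrix.conjTranspose_conjTranspose, h1]
    · rw [Matrix.det_conjTranspose, hU.2, star_one]
  have canc : ∀ X : Mat n, U * (Uᴴ * X * U) * Uᴴ = X := fun X => by
    calc U * (Uᴴ * X * U) * Uᴴ = (U * Uᴴ) * X * (U * Uᴴ) := by simp only [Matrix.mul_assoc]
      _ = X := by rw [h2, Matrix.one_mul, Matrix.mul_one]
  have canc' : ∀ X : Mat n, Uᴴ * (U * X * Uᴴ) * U = X := fun X => by
    calc Uᴴ * (U * X * Uᴴ) * U = (Uᴴ * U) * X * (Uᴴ * U) := by simp only [Matrix.mul_assoc]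
      _ = X := by rw [h1, Matrix.one_mul, Matrix.mul_one]
  ext Ω
  constructor
  · intro hΩ
    have := horizontal_conj_mem _ _ hU' hΩ
    rw [Matrix.conjTranspose_conjTranspose, canc'] at this
    exact ⟨_, this, canc Ω⟩
  · rintro ⟨Ω', h, rfl⟩
    exact horizontal_conj_mem _ _ hU h

/-- The real Hilbert-Schmidt form `(A, B) ↦ Re tr (A† B)`. -/
def hsForm (n : ℕ) : LinearMap.BilinForm ℝ (Mat n) :=
  LinearMap.mk₂ ℝ (fun A B => ((Aᴴ * B).trace).re)
    (by intro A A' B; simp [Matrix.add_mul])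
    (by intro c A B; simp [Matrix.conjTranspose_smul])
    (by intro A B B'; simp [Matrix.mul_add])
    (by intro c A B; simp)

/-- Every tangent vector at `ρ` is `[ρ, Ω]` for exactly one `Ω ∈ 𝔭_ρ`. -/
theorem existsUnique_lift {n : ℕ} (ρ ξ : Mat n) (hξ : ξ ∈ tangentSpace ρ) :
    ∃! Ω : Mat n, Ω ∈ horizontal ρ ∧ adMap ρ Ω = ξ := by
  have hpos : ∀ A : Mat n, ((Aᴴ * A).trace).re = 0 → A = 0 := by
    intro A hA
    open scoped ComplexOrder in
    rw [← Matrix.trace_conjTranspose_mul_self_eq_zero_iff]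
    apply Complex.ext hA
    have h : star ((Aᴴ * A).trace) = (Aᴴ * A).trace := by
      rw [← Matrix.trace_conjTranspose]; simp [Matrix.conjTranspose_mul]
    have h' := congrArg Complex.im h
    simp only [Complex.star_def, Complex.conj_im] at h'
    simp only [Complex.zero_im]
    linarith
  have hsymm : ∀ A B : Mat n, hsForm n A B = hsForm n B A := by
    intro A B
    have h : (Bᴴ * A).trace = star ((Aᴴ * B).trace) := by
      rw [← Matrix.trace_conjTranspose]; simp [Matrix.conjTranspose_mul]
    simp [hsForm, h]
  have hreal : ∀ A ∈ su n, ∀ B ∈ su n, ((Aᴴ * B).trace).im = 0 := by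
    rintro A ⟨hA, -⟩ B ⟨hB, -⟩
    have h : star ((Aᴴ * B).trace) = (Aᴴ * B).trace := by
      rw [← Matrix.trace_conjTranspose, Matrix.conjTranspose_mul,
        Matrix.conjTranspose_conjTranspose, hB, hA, Matrix.trace_mul_comm]
      simp
    have h' := congrArg Complex.im h
    simp only [Complex.star_def, Complex.conj_im] at h'
    linarith
  obtain ⟨Ω, hΩ, rfl⟩ := hξ
  have hcompl : IsCompl (stabAlg ρ) ((hsForm n).orthogonal (stabAlg ρ)) := by
    refine (LinearMap.BilinForm.isCompl_orthogonal_iff_disjoint (W := stabAlg ρ)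
      (fun A B h => by rw [hsymm]; exact h)).2 ?_
    rw [Submodule.disjoint_def]
    intro A hA hA'
    exact hpos A (hA' A hA)
  obtain ⟨a, ha, b, hb, hab⟩ : ∃ a ∈ stabAlg ρ, ∃ b ∈ (hsForm n).orthogonal (stabAlg ρ),
      a + b = Ω := by
    have : Ω ∈ stabAlg ρ ⊔ (hsForm n).orthogonal (stabAlg ρ) := by
      rw [hcompl.sup_eq_top]; trivial
    exact Submodule.mem_sup.1 this
  have hbsu : b ∈ su n := by
    have : b = Ω - a := by rw [← hab]; abel
    rw [this]
    exact (su n).sub_mem hΩ ha.1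
  refine ⟨b, ⟨⟨hbsu, fun Ω' h' => ?_⟩, ?_⟩, ?_⟩
  · refine Complex.ext ?_ (hreal b hbsu Ω' h'.1)
    have : hsForm n Ω' b = 0 := hb Ω' h'
    rw [hsymm] at this
    exact this
  · have h0 : adMap ρ a = 0 := ha.2
    rw [← hab, map_add, h0, zero_add]
  · rintro c ⟨⟨hc, hc'⟩, hc''⟩
    have hmem : c - b ∈ stabAlg ρ := by
      refine ⟨(su n).sub_mem hc hbsu, ?_⟩
      have h0 : adMap ρ a = 0 := ha.2
      change adMap ρ (c - b) = 0
      rw [map_sub, hc'', ← hab, map_add, h0, zero_add, sub_self]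
    refine sub_eq_zero.1 (hpos _ ?_)
    have e1 : ((cᴴ * (c - b)).trace).re = 0 := by rw [hc' _ hmem]; simp
    have e2 : ((bᴴ * (c - b)).trace).re = 0 := by
      have : hsForm n (c - b) b = 0 := hb _ hmem
      rw [hsymm] at this
      exact this
    rw [Matrix.conjTranspose_sub, Matrix.sub_mul, Matrix.trace_sub, Complex.sub_re, e1, e2, sub_zero]

open scoped Classical in
/-- The unique `Ω ∈ 𝔭_ρ` with `[ρ, Ω] = ξ`, for `ξ ∈ T_ρ 𝒪(ρ₀)` (and `0` for other `ξ`). -/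
def lift {n : ℕ} (ρ ξ : Mat n) : Mat n :=
  if h : ξ ∈ tangentSpace ρ then (existsUnique_lift ρ ξ h).choose else 0

/-- The Riemannian metric of the orbit:
`⟨ad_ρ Ω₁, ad_ρ Ω₂⟩_ρ = tr (Ω₁^𝔭† Ω₂^𝔭)`, where `Ω^𝔭` is the component of `Ω` in `𝔭_ρ`, i.e. the
element of `𝔭_ρ` with `ad_ρ Ω^𝔭 = ad_ρ Ω`.  The trace is real because `𝔭_ρ ⊆ 𝔰𝔲(n)`. -/
def metric {n : ℕ} (ρ ξ η : Mat n) : ℝ := (((lift ρ ξ)ᴴ * lift ρ η).trace).re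

/-- `ρ` solves `ρ' = [H₀ + u H₁, ρ]` on `[0,T]`, `ρ(0) = ρ₀`, in the sense of Carathéodory
(the right-hand side is only in `L²`): `ρ` is continuous and satisfies the integral equation. -/
def IsTrajectory {n : ℕ} {T : ℝ} (H₀ H₁ ρ₀ : Mat n) (u : Control T) (ρ : ℝ → Mat n) : Prop :=
  ContinuousOn ρ (Icc 0 T) ∧ ∀ t ∈ Icc 0 T,
    ρ t = ρ₀ + ∫ s in (0 : ℝ)..t,
      ((H₀ + u s • H₁) * ρ s - ρ s * (H₀ + u s • H₁))

open scoped Classical in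
/-- The end-point map `End_{ρ₀}(u) = ρ(T)`. -/
def endPoint {n : ℕ} {T : ℝ} (H₀ H₁ ρ₀ : Mat n) (u : Control T) : Mat n :=
  if h : ∃ ρ, IsTrajectory H₀ H₁ ρ₀ u ρ then h.choose T else 0

/-- The differential `d End_{ρ₀}(u)`. -/
def dEnd {n : ℕ} {T : ℝ} (H₀ H₁ ρ₀ : Mat n) (u : Control T) : Control T →L[ℝ] Mat n :=
  fderiv ℝ (fun w : Control T => endPoint H₀ H₁ ρ₀ w) u

/-- `A` is an adjoint of `d End_{ρ₀}(u)`: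
`⟨z, d End(u) v⟩_{End(u)} = (A z, v)` for all `z ∈ T_{End(u)} 𝒪(ρ₀)` and `v ∈ L²([0,T])`. -/
def IsAdjoint {n : ℕ} {T : ℝ} (H₀ H₁ ρ₀ : Mat n) (u : Control T)
    (A : tangentSpace (endPoint H₀ H₁ ρ₀ u) →ₗ[ℝ] Control T) : Prop :=
  ∀ (z : tangentSpace (endPoint H₀ H₁ ρ₀ u)) (v : Control T),
    metric (endPoint H₀ H₁ ρ₀ u) z (dEnd H₀ H₁ ρ₀ u v) = inner ℝ (A z) v

open scoped Classical in
/-- The adjoint operator `d End_{ρ₀}^*(u) : T_{End(u)} 𝒪(ρ₀) → L²([0,T])`. -/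
def dEndAdj {n : ℕ} {T : ℝ} (H₀ H₁ ρ₀ : Mat n) (u : Control T) :
    tangentSpace (endPoint H₀ H₁ ρ₀ u) →ₗ[ℝ] Control T :=
  if h : ∃ A, IsAdjoint H₀ H₁ ρ₀ u A then h.choose else 0

/-- The cost `J(ρ) = Re tr (ρ θ)`. -/
def costJ {n : ℕ} (θ ρ : Mat n) : ℝ := ((ρ * θ).trace).re

/-- `ζ` is a gradient of `J` at the point `ρ` of the orbit: `dJ(ρ) η = ⟨ζ, η⟩_ρ` for all tangent
vectors `η`.  The differential of `J` on the orbit is that of `J` on matrices, restricted to the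
tangent space. -/
def IsGradJ {n : ℕ} (θ ρ : Mat n) (ζ : tangentSpace ρ) : Prop :=
  ∀ η : tangentSpace ρ, fderiv ℝ (costJ θ) ρ (η : Mat n) = metric ρ ζ η

open scoped Classical in
/-- The Riemannian gradient `∇J(ρ) ∈ T_ρ 𝒪(ρ₀)`. -/
def gradJ {n : ℕ} (θ ρ : Mat n) : tangentSpace ρ :=
  if h : ∃ ζ, IsGradJ θ ρ ζ then h.choose else 0

/-- The right-hand side `d End_{ρ₀}^*(u) ∇J(End_{ρ₀}(u))` of the gradient flow. -/
def flowField {n : ℕ} {T : ℝ} (H₀ H₁ ρ₀ θ : Mat n) (u : Control T) : Control T :=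
  dEndAdj H₀ H₁ ρ₀ u (gradJ θ (endPoint H₀ H₁ ρ₀ u))

/-- `P` solves `dP/ds = d End^*(P) ∇J(End(P))`, `P(0) = u₀`, on the interval `I` (which contains
`0`); the derivative is that of the strong topology of `L²([0,T])`, one-sided at the ends of `I`. -/
def IsFlowSolution {n : ℕ} {T : ℝ} (H₀ H₁ ρ₀ θ : Mat n) (u₀ : Control T) (I : Set ℝ)
    (P : ℝ → Control T) : Prop :=
  P 0 = u₀ ∧ ∀ s ∈ I, HasDerivWithinAt P (flowField H₀ H₁ ρ₀ θ (P s)) I s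

end QuantumControl

end

open QuantumControl

/-
Let `U` be the propagator of `H₀ + u H₁`, so that `End(u) = U(T) ρ₀ U(T)†`. It is unitary, hence
bounded independently of `u` and `H₀`. For the propagator `V` of another control `v`, Duhamel's
formula `V(t) - U(t) = U(t) ∫₀ᵗ (v - u) U† H₁ V` shows that `u ↦ U(t)` is globally Lipschitz and,
applied a second time to the integrand, that
`dEnd(u) w = U(T) [∫₀ᵀ w U† H₁ U, ρ₀] U(T)†`.
Thus `u ↦ dEnd(u)` is bounded and Lipschitz on all of `L²`. Since the defining
properties of `∇J` and of the adjoint identify the flow field with the Riesz representative of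
`J ∘ dEnd(u)`, whatever the metric on the orbit, and `J` is linear, the flow field is bounded and
Lipschitz too. Picard-Lindelöf then gives solutions on arbitrarily long intervals.
-/

noncomputable section

namespace QuantumControl

open scoped NNReal

section Primitive

variable {E F : Type*} [NormedAddCommGroup E] [NormedAddCommGroup F] {a b t : ℝ}

theorem absolutelyContinuousOnInterval_of_dist_le {X Y Z : Type*} [PseudoMetricSpace X]
    [PseudoMetricSpace Y] [PseudoMetricSpace Z] {f : ℝ → X} {g : ℝ → Y} {h : ℝ → Z} {C D : ℝ}
    (hg : AbsolutelyContinuousOnInterval g a b) (hh : AbsolutelyContinuousOnInterval h a b)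
    (hf : ∀ x ∈ uIcc a b, ∀ y ∈ uIcc a b,
      dist (f x) (f y) ≤ C * dist (g x) (g y) + D * dist (h x) (h y)) :
    AbsolutelyContinuousOnInterval f a b := by
  have hsum := (Filter.Tendsto.const_mul C hg).add (Filter.Tendsto.const_mul D hh)
  rw [mul_zero, mul_zero, add_zero] at hsum
  refine squeeze_zero' (.of_forall fun _ => Finset.sum_nonneg fun _ _ => dist_nonneg) ?_ hsum
  filter_upwards [Filter.mem_inf_of_right (Filter.mem_principal_self _)] with P hP
  rw [Finset.mul_sum, Finset.mul_sum, ← Finset.sum_add_distrib]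
  exact Finset.sum_le_sum fun i hi => hf _ (hP.1 i hi).1 _ (hP.1 i hi).2

theorem absolutelyContinuousOnInterval_mul {A : Type*} [NormedRing A] {f g : ℝ → A}
    (hf : AbsolutelyContinuousOnInterval f a b) (hg : AbsolutelyContinuousOnInterval g a b) :
    AbsolutelyContinuousOnInterval (fun t => f t * g t) a b := by
  obtain ⟨C, hC⟩ := hf.exists_bound
  obtain ⟨D, hD⟩ := hg.exists_bound
  refine absolutelyContinuousOnInterval_of_dist_le (C := D) (D := C) hf hg fun x hx y hy => ?_
  rw [dist_eq_norm, dist_eq_norm, dist_eq_norm]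
  calc ‖f x * g x - f y * g y‖ = ‖(f x - f y) * g x + f y * (g x - g y)‖ := by
        congr 1; noncomm_ring
    _ ≤ ‖f x - f y‖ * ‖g x‖ + ‖f y‖ * ‖g x - g y‖ := norm_add_le_of_le (norm_mul_le _ _)
        (norm_mul_le _ _)
    _ ≤ D * ‖f x - f y‖ + C * ‖g x - g y‖ := by
        rw [mul_comm D]
        gcongr
        exacts [hD x hx, hC y hy]

theorem intervalIntegrable_of_integrableOn_Icc {f : ℝ → E} (hf : IntegrableOn f (Icc a b))
    (ht : t ∈ Icc a b) : IntervalIntegrable f volume a t :=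
  (intervalIntegrable_iff_integrableOn_Icc_of_le ht.1).2 (hf.mono_set (Icc_subset_Icc_right ht.2))

variable [NormedSpace ℝ E] [NormedSpace ℝ F]

theorem absolutelyContinuousOnInterval_add_integral (c : E) {f : ℝ → E}
    (hf : IntervalIntegrable f volume a b) :
    AbsolutelyContinuousOnInterval (fun t => c + ∫ s in a..t, f s) a b := by
  have hn := hf.norm.absolutelyContinuousOnInterval_intervalIntegral left_mem_uIcc
  refine absolutelyContinuousOnInterval_of_dist_le (C := 1) (D := 0) hn hn fun x hx y hy => ?_
  have hsub : ∀ {z}, z ∈ uIcc a b → uIcc a z ⊆ uIcc a b := uIcc_subset_uIcc_left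
  rw [one_mul, zero_mul, add_zero, dist_add_left, dist_eq_norm, dist_eq_norm, Real.norm_eq_abs,
    intervalIntegral.integral_interval_sub_left (hf.mono_set (hsub hx)) (hf.mono_set (hsub hy)),
    intervalIntegral.integral_interval_sub_left (hf.norm.mono_set (hsub hx))
      (hf.norm.mono_set (hsub hy))]
  exact intervalIntegral.norm_integral_le_abs_integral_norm

theorem integral_eq_sub_of_absolutelyContinuousOnInterval [CompleteSpace E] {f f' : ℝ → E}
    (hf : AbsolutelyContinuousOnInterval f a b) (hf' : IntervalIntegrable f' volume a b)
    (hderiv : ∀ᵐ t, t ∈ uIcc a b → HasDerivAt f (f' t) t) :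
    ∫ t in a..b, f' t = f b - f a := by
  obtain ⟨c, hc⟩ := (hf.sub (absolutelyContinuousOnInterval_add_integral 0
    hf')).const_of_ae_hasDerivAt_zero (by
      filter_upwards [hderiv, hf'.ae_hasDerivAt_integral] with t htf htI ht
      simpa using (htf ht).sub ((htI ht a left_mem_uIcc).const_add 0))
  have hab := (hc b right_mem_uIcc).trans (hc a left_mem_uIcc).symm
  simp only [Pi.sub_apply, intervalIntegral.integral_same, zero_add, sub_zero] at hab
  rw [← hab, sub_sub_cancel]

/-- `f` is absolutely continuous on `[a, b]` with integrable almost everywhere derivative `f'`. -/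
def IsPrimitiveOn (f f' : ℝ → E) (a b : ℝ) : Prop :=
  IntegrableOn f' (Icc a b) ∧ ∀ t ∈ Icc a b, f t = f a + ∫ s in a..t, f' s

namespace IsPrimitiveOn

theorem const (c : E) : IsPrimitiveOn (fun _ => c) (fun _ => 0) a b :=
  ⟨integrableOn_zero, fun t _ => by simp⟩

theorem add_integral {f' : ℝ → E} (c : E) (hf' : IntegrableOn f' (Icc a b)) :
    IsPrimitiveOn (fun t => c + ∫ s in a..t, f' s) f' a b :=
  ⟨hf', fun t _ => by simp⟩

variable {f f' : ℝ → E}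

theorem eq_left_of_deriv_zero (hf : IsPrimitiveOn f (fun _ => 0) a b) (ht : t ∈ Icc a b) :
    f t = f a := by
  simpa using hf.2 t ht

theorem continuousOn (hf : IsPrimitiveOn f f' a b) : ContinuousOn f (Icc a b) := by
  have h : ContinuousOn (fun t => f a + ∫ s in Ioc a t, f' s) (Icc a b) :=
    continuousOn_const.add (intervalIntegral.continuousOn_primitive hf.1)
  refine h.congr fun t ht => ?_
  rw [hf.2 t ht, intervalIntegral.integral_of_le ht.1]

theorem clm_comp [CompleteSpace E] [CompleteSpace F] (hf : IsPrimitiveOn f f' a b)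
    (L : E →L[ℝ] F) : IsPrimitiveOn (fun t => L (f t)) (fun t => L (f' t)) a b := by
  refine ⟨L.integrable_comp hf.1, fun t ht => ?_⟩
  rw [L.intervalIntegral_comp_comm (intervalIntegrable_of_integrableOn_Icc hf.1 ht), ← map_add,
    ← hf.2 t ht]

variable {A : Type*} [NormedRing A] [NormedAlgebra ℝ A] [CompleteSpace A] {f f' g g' : ℝ → A}

theorem mul (hf : IsPrimitiveOn f f' a b) (hg : IsPrimitiveOn g g' a b) :
    IsPrimitiveOn (fun t => f t * g t) (fun t => f' t * g t + f t * g' t) a b := by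
  have hint : IntegrableOn (fun t => f' t * g t + f t * g' t) (Icc a b) :=
    (hf.1.mul_continuousOn hg.continuousOn isCompact_Icc).add
      (hg.1.continuousOn_mul hf.continuousOn isCompact_Icc)
  refine ⟨hint, fun t ht => ?_⟩
  have hf' := intervalIntegrable_of_integrableOn_Icc hf.1 ht
  have hg' := intervalIntegrable_of_integrableOn_Icc hg.1 ht
  have hderiv : ∀ᵐ s, s ∈ uIcc a t → HasDerivAt
      (fun s => (f a + ∫ r in a..s, f' r) * (g a + ∫ r in a..s, g' r))
      (f' s * g s + f s * g' s) s := by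
    filter_upwards [hf'.ae_hasDerivAt_integral, hg'.ae_hasDerivAt_integral] with s hsf hsg hs
    have hmem : s ∈ Icc a b := Icc_subset_Icc_right ht.2 (by rwa [uIcc_of_le ht.1] at hs)
    rw [hf.2 s hmem, hg.2 s hmem]
    exact ((hsf hs a left_mem_uIcc).const_add _).mul ((hsg hs a left_mem_uIcc).const_add _)
  have hAC := absolutelyContinuousOnInterval_mul
      (absolutelyContinuousOnInterval_add_integral (f a) hf')
      (absolutelyContinuousOnInterval_add_integral (g a) hg')
  have hFTC := integral_eq_sub_of_absolutelyContinuousOnInterval hAC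
    (intervalIntegrable_of_integrableOn_Icc hint ht) hderiv
  rw [hFTC, ← hf.2 t ht, ← hg.2 t ht]
  simp only [intervalIntegral.integral_same, add_zero, add_sub_cancel]

theorem star [StarRing A] [NormedStarGroup A] [StarModule ℝ A] (hf : IsPrimitiveOn f f' a b) :
    IsPrimitiveOn (fun t => star (f t)) (fun t => star (f' t)) a b :=
  hf.clm_comp (starL' ℝ : A ≃L[ℝ] A).toContinuousLinearMap

theorem pow_succ {A : Type*} [NormedCommRing A] [NormedAlgebra ℝ A] [CompleteSpace A]
    {f f' : ℝ → A} (hf : IsPrimitiveOn f f' a b) (n : ℕ) :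
    IsPrimitiveOn (fun t => f t ^ (n + 1)) (fun t => (n + 1) * f t ^ n * f' t) a b := by
  induction n with
  | zero => simpa using hf
  | succ n ih =>
    convert ih.mul hf using 2
    · exact _root_.pow_succ _ _
    · push_cast
      ring

end IsPrimitiveOn

end Primitive

section LinearODE

variable {E G : Type*} [NormedAddCommGroup E] [NormedSpace ℝ E] [NormedAddCommGroup G]
  [NormedSpace ℝ G] {a b : ℝ}

theorem integrableOn_clm_apply {F : ℝ → E →L[ℝ] G} {g : ℝ → E} (hF : IntegrableOn F (Icc a b))
    (hg : ContinuousOn g (Icc a b)) : IntegrableOn (fun t => F t (g t)) (Icc a b) := by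
  obtain ⟨C, hC⟩ := isCompact_Icc.exists_bound_of_continuousOn hg
  exact (ContinuousLinearMap.id ℝ (E →L[ℝ] G)).integrable_of_bilin_of_bdd_right C hF
    (hg.aestronglyMeasurable measurableSet_Icc) (ae_restrict_of_forall_mem measurableSet_Icc hC)

variable {F : ℝ → E →L[ℝ] E}

theorem integrableOn_clm_apply_IccExtend (hab : a ≤ b) (hF : IntegrableOn F (Icc a b))
    (f : C(Icc a b, E)) :
    IntegrableOn (fun t => F t (IccExtend hab f t)) (Icc a b) :=
  integrableOn_clm_apply hF (f.continuous.Icc_extend' (h := hab)).continuousOn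

/-- The Picard operator `f ↦ (t ↦ x₀ + ∫ s in a..t, F s (f s))` of the linear initial value problem
`x' = F x`, `x a = x₀`, on the space of continuous functions on `[a, b]`. -/
def picardMap (hab : a ≤ b) (hF : IntegrableOn F (Icc a b)) (x₀ : E) (f : C(Icc a b, E)) :
    C(Icc a b, E) where
  toFun t := x₀ + ∫ s in a..t, F s (IccExtend hab f s)
  continuous_toFun := (IsPrimitiveOn.add_integral x₀
    (integrableOn_clm_apply_IccExtend hab hF f)).continuousOn.domRestrict

theorem isPrimitiveOn_of_isFixedPt_picardMap (hab : a ≤ b) (hF : IntegrableOn F (Icc a b)) {x₀ : E}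
    {f : C(Icc a b, E)}
    (hf : Function.IsFixedPt (picardMap hab hF x₀) f) :
    IccExtend hab f a = x₀ ∧
      IsPrimitiveOn (IccExtend hab f) (fun t => F t (IccExtend hab f t)) a b := by
  have hpicard : ∀ t ∈ Icc a b,
      IccExtend hab f t = x₀ + ∫ s in a..t, F s (IccExtend hab f s) := fun t ht => by
    rw [IccExtend_of_mem hab _ ht]
    exact (DFunLike.congr_fun hf ⟨t, ht⟩).symm
  have hleft : IccExtend hab f a = x₀ := by
    rw [hpicard a (left_mem_Icc.2 hab), intervalIntegral.integral_same, add_zero]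
  exact ⟨hleft, integrableOn_clm_apply_IccExtend hab hF f, fun t ht => by
    rw [hleft, ← hpicard t ht]⟩

theorem integral_primitive_pow_mul {m : ℝ → ℝ} (hm : IntegrableOn m (Icc a b)) {t : ℝ}
    (ht : t ∈ Icc a b) (n : ℕ) :
    ∫ s in a..t, (∫ r in a..s, m r) ^ n / n.factorial * m s =
      (∫ s in a..t, m s) ^ (n + 1) / (n + 1).factorial := by
  have hpow := ((IsPrimitiveOn.add_integral 0 hm).pow_succ n).2 t ht
  simp only [zero_add, intervalIntegral.integral_same, ne_eq, n.succ_ne_zero, not_false_eq_true,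
    zero_pow] at hpow
  rw [hpow, ← intervalIntegral.integral_div]
  refine intervalIntegral.integral_congr fun s _ => ?_
  rw [Nat.factorial_succ]
  push_cast
  field_simp

theorem dist_picardMap_iterate_apply_le (hab : a ≤ b) (hF : IntegrableOn F (Icc a b)) (x₀ : E)
    (f g : C(Icc a b, E)) (n : ℕ) (t : Icc a b) :
    dist ((picardMap hab hF x₀)^[n] f t) ((picardMap hab hF x₀)^[n] g t) ≤
      (∫ s in a..t, ‖F s‖) ^ n / n.factorial * dist f g := by
  induction n generalizing t with
  | zero => simpa using ContinuousMap.dist_apply_le_dist t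
  | succ n ih =>
    rw [Function.iterate_succ_apply', Function.iterate_succ_apply', dist_eq_norm]
    set f' := (picardMap hab hF x₀)^[n] f
    set g' := (picardMap hab hF x₀)^[n] g
    have hint : ∀ h : C(Icc a b, E),
        IntervalIntegrable (fun s => F s (IccExtend hab h s)) volume a t := fun h =>
      intervalIntegrable_of_integrableOn_Icc (integrableOn_clm_apply_IccExtend hab hF h) t.2
    have hbound : IntegrableOn (fun s => (∫ r in a..s, ‖F r‖) ^ n / n.factorial * ‖F s‖ *
        dist f g) (Icc a b) := by
      have hm := IsPrimitiveOn.add_integral 0 hF.norm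
      simp only [zero_add] at hm
      exact (hm.1.continuousOn_mul ((hm.continuousOn.pow n).div_const _)
        isCompact_Icc).mul_const _
    calc ‖picardMap hab hF x₀ f' t - picardMap hab hF x₀ g' t‖
        = ‖∫ s in a..t, (F s (IccExtend hab f' s) - F s (IccExtend hab g' s))‖ := by
          rw [intervalIntegral.integral_sub (hint f') (hint g')]
          exact congrArg _ (add_sub_add_left_eq_sub _ _ _)
      _ ≤ ∫ s in a..t, (∫ r in a..s, ‖F r‖) ^ n / n.factorial * ‖F s‖ * dist f g := by
          refine intervalIntegral.norm_integral_le_of_norm_le t.2.1 (.of_forall fun s hs => ?_)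
            (intervalIntegrable_of_integrableOn_Icc hbound t.2)
          have hs' : s ∈ Icc a b := ⟨hs.1.le, hs.2.trans t.2.2⟩
          rw [IccExtend_of_mem hab _ hs', IccExtend_of_mem hab _ hs', ← map_sub]
          have hdist := ih ⟨s, hs'⟩
          rw [dist_eq_norm] at hdist
          exact ((F s).le_of_opNorm_le_of_le le_rfl hdist).trans_eq (by ring)
      _ = (∫ s in a..t, ‖F s‖) ^ (n + 1) / (n + 1).factorial * dist f g := by
          rw [intervalIntegral.integral_mul_const, integral_primitive_pow_mul hF.norm t.2]

theorem exists_contractingWith_iterate_picardMap (hab : a ≤ b) (hF : IntegrableOn F (Icc a b))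
    (x₀ : E) :
    ∃ (n : ℕ) (C : ℝ≥0), ContractingWith C (picardMap hab hF x₀)^[n] := by
  obtain ⟨n, hn⟩ := FloorSemiring.tendsto_pow_div_factorial_atTop (∫ s in a..b, ‖F s‖)
    |>.eventually (gt_mem_nhds zero_lt_one) |>.exists
  have hmono : ∀ t ∈ Icc a b, 0 ≤ ∫ s in a..t, ‖F s‖ ∧
      ∫ s in a..t, ‖F s‖ ≤ ∫ s in a..b, ‖F s‖ := fun t ht =>
    ⟨intervalIntegral.integral_nonneg ht.1 fun _ _ => norm_nonneg _,
      intervalIntegral.integral_mono_interval le_rfl ht.1 ht.2 (.of_forall fun _ => norm_nonneg _)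
        (intervalIntegrable_of_integrableOn_Icc hF.norm (right_mem_Icc.2 hab))⟩
  have hnonneg : 0 ≤ (∫ s in a..b, ‖F s‖) ^ n / n.factorial :=
    div_nonneg (pow_nonneg (hmono b (right_mem_Icc.2 hab)).1 _) (Nat.cast_nonneg _)
  refine ⟨n, ⟨_, hnonneg⟩, hn, LipschitzWith.of_dist_le_mul fun f g => ?_⟩
  refine (ContinuousMap.dist_le (by positivity)).2 fun t => ?_
  obtain ⟨ht_nonneg, ht_le⟩ := hmono t t.2
  calc _ ≤ (∫ s in a..t, ‖F s‖) ^ n / n.factorial * dist f g :=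
        dist_picardMap_iterate_apply_le hab hF x₀ f g n t
    _ ≤ (∫ s in a..b, ‖F s‖) ^ n / n.factorial * dist f g := by gcongr

theorem exists_isPrimitiveOn_clm_apply [CompleteSpace E] (hF : IntegrableOn F (Icc a b)) (x₀ : E) :
    ∃ x : ℝ → E, x a = x₀ ∧ IsPrimitiveOn x (fun t => F t (x t)) a b := by
  rcases le_or_gt a b with hab | hba
  · obtain ⟨n, C, hC⟩ := exists_contractingWith_iterate_picardMap hab hF x₀
    exact ⟨_, isPrimitiveOn_of_isFixedPt_picardMap hab hF hC.isFixedPt_fixedPoint_iterate⟩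
  · exact ⟨fun _ => x₀, rfl, by simp [IsPrimitiveOn, Icc_eq_empty hba.not_ge]⟩

end LinearODE

section Propagator

variable {A : Type*} [NormedRing A] [NormedAlgebra ℝ A]

/-- `U` is the propagator of the time-dependent generator `X` on `[a, b]`: the absolutely continuous
solution of `U' = X U` with `U a = 1`. -/
def IsPropagator (X U : ℝ → A) (a b : ℝ) : Prop :=
  U a = 1 ∧ IsPrimitiveOn U (fun t => X t * U t) a b

variable [CompleteSpace A] {X Y U V : ℝ → A} {a b t : ℝ}

theorem exists_isPropagator (hX : IntegrableOn X (Icc a b)) : ∃ U, IsPropagator X U a b :=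
  exists_isPrimitiveOn_clm_apply ((ContinuousLinearMap.mul ℝ A).integrable_comp hX) 1

namespace IsPropagator

variable [StarRing A] [NormedStarGroup A] [StarModule ℝ A]

theorem isPrimitiveOn_star_mul (hU : IsPropagator X U a b) (hV : IsPropagator Y V a b)
    (hX : ∀ t, X t ∈ skewAdjoint A) :
    IsPrimitiveOn (fun t => star (U t) * V t) (fun t => star (U t) * (Y t - X t) * V t) a b := by
  convert hU.2.star.mul hV.2 using 2 with t
  rw [star_mul, skewAdjoint.mem_iff.1 (hX t)]
  noncomm_ring

theorem star_mul_self (hU : IsPropagator X U a b) (hX : ∀ t, X t ∈ skewAdjoint A)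
    (ht : t ∈ Icc a b) : star (U t) * U t = 1 := by
  have hderiv := hU.isPrimitiveOn_star_mul hU hX
  simp only [sub_self, mul_zero, zero_mul] at hderiv
  simpa [hU.1] using hderiv.eq_left_of_deriv_zero ht

theorem isPrimitiveOn_conj (hU : IsPropagator X U a b) (hX : ∀ t, X t ∈ skewAdjoint A) (ρ₀ : A) :
    IsPrimitiveOn (fun t => U t * ρ₀ * star (U t))
      (fun t => X t * (U t * ρ₀ * star (U t)) - U t * ρ₀ * star (U t) * X t) a b := by
  convert (hU.2.mul (.const ρ₀)).mul hU.2.star using 2 with t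
  rw [star_mul, skewAdjoint.mem_iff.1 (hX t)]
  noncomm_ring

variable [IsDedekindFiniteMonoid A]

theorem mem_unitary (hU : IsPropagator X U a b) (hX : ∀ t, X t ∈ skewAdjoint A)
    (ht : t ∈ Icc a b) : U t ∈ unitary A :=
  ⟨hU.star_mul_self hX ht, mul_eq_one_symm (hU.star_mul_self hX ht)⟩

theorem eq_conj_of_isPrimitiveOn (hU : IsPropagator X U a b) (hX : ∀ t, X t ∈ skewAdjoint A)
    {ρ : ℝ → A} (hρ : IsPrimitiveOn ρ (fun t => X t * ρ t - ρ t * X t) a b) (ht : t ∈ Icc a b) :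
    ρ t = U t * ρ a * star (U t) := by
  have hconst : star (U t) * ρ t * U t = ρ a := by
    have hderiv := (hU.2.star.mul hρ).mul hU.2
    have hzero : (fun t => (star (X t * U t) * ρ t + star (U t) * (X t * ρ t - ρ t * X t)) * U t +
        star (U t) * ρ t * (X t * U t)) = fun _ => 0 := by
      funext t
      rw [star_mul, skewAdjoint.mem_iff.1 (hX t)]
      noncomm_ring
    rw [hzero] at hderiv
    simpa [hU.1] using hderiv.eq_left_of_deriv_zero ht
  have hunitary : U t * star (U t) = 1 := (hU.mem_unitary hX ht).2
  calc ρ t = U t * star (U t) * ρ t * (U t * star (U t)) := by rw [hunitary, one_mul, mul_one]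
    _ = U t * (star (U t) * ρ t * U t) * star (U t) := by simp only [mul_assoc]
    _ = U t * ρ a * star (U t) := by rw [hconst]

end IsPropagator

end Propagator

section ControlIntegral

variable {E : Type*} [NormedAddCommGroup E] [NormedSpace ℝ E] {T : ℝ} {f g : ℝ → E} {M : ℝ}

theorem integrableOn_control (w : Control T) : IntegrableOn w (Icc 0 T) :=
  (Lp.memLp w).integrable one_le_two

theorem integrableOn_control_smul (w : Control T) (hf : ContinuousOn f (Icc 0 T)) :
    IntegrableOn (fun t => w t • f t) (Icc 0 T) :=
  (integrableOn_control w).smul_continuousOn hf isCompact_Icc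

theorem integral_norm_control_le (w : Control T) : ∫ t in Icc 0 T, ‖w t‖ ≤ √T * ‖w‖ := by
  have hexponent : 1 / (1 : ENNReal).toReal - 1 / (2 : ENNReal).toReal = 1 / 2 := by norm_num
  have hHolder := eLpNorm_le_eLpNorm_mul_rpow_measure_univ one_le_two
    (Lp.aestronglyMeasurable w)
  rw [hexponent, Measure.restrict_apply_univ, Real.volume_Icc, sub_zero] at hHolder
  have hfinite : eLpNorm w 2 (volume.restrict (Icc 0 T)) * ENNReal.ofReal T ^ (1 / 2 : ℝ) ≠ ⊤ :=
    ENNReal.mul_ne_top (Lp.eLpNorm_ne_top w) (by finiteness)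
  rw [integral_norm_eq_lintegral_enorm (Lp.aestronglyMeasurable w),
    ← eLpNorm_one_eq_lintegral_enorm]
  refine (ENNReal.toReal_mono hfinite hHolder).trans_eq ?_
  rw [ENNReal.toReal_mul, ← Lp.norm_def, ← ENNReal.toReal_rpow, ENNReal.toReal_ofReal',
    ← Real.sqrt_eq_rpow, mul_comm]
  rcases le_total T 0 with hT | hT
  · rw [max_eq_right hT, Real.sqrt_zero, Real.sqrt_eq_zero_of_nonpos hT]
  · rw [max_eq_left hT]

theorem norm_setIntegral_control_smul_le (w : Control T) {S : Set ℝ} (hS : MeasurableSet S)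
    (hST : S ⊆ Icc 0 T) (hM : 0 ≤ M) (hf : ∀ t ∈ Icc 0 T, ‖f t‖ ≤ M) :
    ‖∫ t in S, w t • f t‖ ≤ M * √T * ‖w‖ := by
  have hint : IntegrableOn (fun t => M * ‖w t‖) (Icc 0 T) :=
    (integrableOn_control w).norm.const_mul M
  calc ‖∫ t in S, w t • f t‖ ≤ ∫ t in S, M * ‖w t‖ := by
        refine norm_integral_le_of_norm_le (hint.mono_set hST)
          (ae_restrict_of_forall_mem hS fun t ht => ?_)
        rw [norm_smul, mul_comm]
        exact mul_le_mul_of_nonneg_right (hf t (hST ht)) (norm_nonneg _)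
    _ ≤ ∫ t in Icc 0 T, M * ‖w t‖ := setIntegral_mono_set hint
        (.of_forall fun t => mul_nonneg hM (norm_nonneg _)) hST.eventuallyLE
    _ ≤ M * (√T * ‖w‖) := by
        rw [integral_const_mul]
        exact mul_le_mul_of_nonneg_left (integral_norm_control_le w) hM
    _ = M * √T * ‖w‖ := (mul_assoc _ _ _).symm

theorem exists_norm_setIntegral_control_smul_le (hf : ContinuousOn f (Icc 0 T)) :
    ∃ C, ∀ w : Control T, ‖∫ t in Icc 0 T, w t • f t‖ ≤ C * ‖w‖ := by
  obtain ⟨M, hM⟩ := isCompact_Icc.exists_bound_of_continuousOn hf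
  exact ⟨|M| * √T, fun w => norm_setIntegral_control_smul_le w measurableSet_Icc subset_rfl
    (abs_nonneg M) fun t ht => (hM t ht).trans (le_abs_self M)⟩

/-- The integration of controls against a continuous function `f`, as a continuous linear map. -/
def controlIntegral (hf : ContinuousOn f (Icc 0 T)) : Control T →L[ℝ] E :=
  LinearMap.mkContinuousOfExistsBound
    { toFun := fun w => ∫ t in Icc 0 T, w t • f t
      map_add' := fun v w => by
        rw [← integral_add (integrableOn_control_smul v hf) (integrableOn_control_smul w hf)]
        refine integral_congr_ae ?_
        filter_upwards [Lp.coeFn_add v w] with t ht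
        rw [ht, Pi.add_apply, add_smul]
      map_smul' := fun r w => by
        rw [RingHom.id_apply, ← integral_smul]
        refine integral_congr_ae ?_
        filter_upwards [Lp.coeFn_smul r w] with t ht
        rw [ht, Pi.smul_apply, smul_assoc] }
    (exists_norm_setIntegral_control_smul_le hf)

theorem controlIntegral_apply (hf : ContinuousOn f (Icc 0 T)) (w : Control T) :
    controlIntegral hf w = ∫ t in Icc 0 T, w t • f t :=
  rfl

theorem controlIntegral_sub (hf : ContinuousOn f (Icc 0 T)) (hg : ContinuousOn g (Icc 0 T)) :
    controlIntegral (hf.sub hg) = controlIntegral hf - controlIntegral hg := by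
  ext w
  simp only [sub_apply, controlIntegral_apply, Pi.sub_apply, smul_sub]
  exact integral_sub (integrableOn_control_smul w hf) (integrableOn_control_smul w hg)

theorem norm_controlIntegral_le (hf : ContinuousOn f (Icc 0 T)) (hM : 0 ≤ M)
    (hfM : ∀ t ∈ Icc 0 T, ‖f t‖ ≤ M) : ‖controlIntegral hf‖ ≤ M * √T :=
  ContinuousLinearMap.opNorm_le_bound _ (by positivity) fun w =>
    norm_setIntegral_control_smul_le w measurableSet_Icc subset_rfl hM hfM

end ControlIntegral

section ControlAffine

variable {A : Type*} [NormedRing A] [NormedAlgebra ℝ A] {T t : ℝ} {H₀ H₁ : A}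

theorem integrableOn_controlAffine (H₀ H₁ : A) (u : Control T) :
    IntegrableOn (fun t => H₀ + u t • H₁) (Icc 0 T) :=
  continuousOn_const.integrableOn_Icc.add ((integrableOn_control u).smul_const H₁)

theorem controlAffine_mem_skewAdjoint [StarRing A] [StarModule ℝ A] (h₀ : H₀ ∈ skewAdjoint A)
    (h₁ : H₁ ∈ skewAdjoint A) (u : Control T) (t : ℝ) : H₀ + u t • H₁ ∈ skewAdjoint A :=
  add_mem h₀ (skewAdjoint.smul_mem _ h₁)

variable [CompleteSpace A]

/-- The propagator of the control system `U' = (H₀ + u H₁) U`, `U 0 = 1`. -/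
def propagator (H₀ H₁ : A) (u : Control T) : ℝ → A :=
  (exists_isPropagator (integrableOn_controlAffine H₀ H₁ u)).choose

theorem isPropagator_propagator (H₀ H₁ : A) (u : Control T) :
    IsPropagator (fun t => H₀ + u t • H₁) (propagator H₀ H₁ u) 0 T :=
  (exists_isPropagator (integrableOn_controlAffine H₀ H₁ u)).choose_spec

theorem continuousOn_propagator (H₀ H₁ : A) (u : Control T) :
    ContinuousOn (propagator H₀ H₁ u) (Icc 0 T) :=
  (isPropagator_propagator H₀ H₁ u).2.continuousOn

variable [StarRing A] [NormedStarGroup A]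

/-- `t ↦ U(t)† H₁ V(t)` for the propagators `U` and `V` of the controls `u` and `v`. For `v = u`
this is the control Hamiltonian in the interaction picture. -/
def interactionPicture (H₀ H₁ : A) (u v : Control T) (t : ℝ) : A :=
  star (propagator H₀ H₁ u t) * H₁ * propagator H₀ H₁ v t

theorem continuousOn_interactionPicture (H₀ H₁ : A) (u v : Control T) :
    ContinuousOn (interactionPicture H₀ H₁ u v) (Icc 0 T) :=
  ((continuousOn_propagator H₀ H₁ u).star.mul continuousOn_const).mul
    (continuousOn_propagator H₀ H₁ v)

/-- The logarithmic derivative of `u ↦ U(T)`: `w ↦ ∫ s in 0..T, w s • U(s)† H₁ U(s)`. -/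
def logDeriv (H₀ H₁ : A) (u : Control T) : Control T →L[ℝ] A :=
  controlIntegral (continuousOn_interactionPicture H₀ H₁ u u)

/-- The derivative of the end-point map `u ↦ U(T) ρ₀ U(T)†`. -/
def endDeriv (H₀ H₁ ρ₀ : A) (u : Control T) : Control T →L[ℝ] A :=
  ContinuousLinearMap.mulLeftRight ℝ A (propagator H₀ H₁ u T) (star (propagator H₀ H₁ u T)) ∘L
    ((ContinuousLinearMap.mul ℝ A).flip ρ₀ - ContinuousLinearMap.mul ℝ A ρ₀) ∘L logDeriv H₀ H₁ u

theorem endDeriv_apply (H₀ H₁ ρ₀ : A) (u w : Control T) :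
    endDeriv H₀ H₁ ρ₀ u w = propagator H₀ H₁ u T *
      (logDeriv H₀ H₁ u w * ρ₀ - ρ₀ * logDeriv H₀ H₁ u w) * star (propagator H₀ H₁ u T) :=
  rfl

variable [StarModule ℝ A]

theorem star_propagator_mul_propagator (h₀ : H₀ ∈ skewAdjoint A) (h₁ : H₁ ∈ skewAdjoint A)
    (u v : Control T) (ht : t ∈ Icc 0 T) :
    star (propagator H₀ H₁ u t) * propagator H₀ H₁ v t = 1 + ∫ s in Ioc 0 t,
      (v - u) s • interactionPicture H₀ H₁ u v s := by
  have hduhamel := ((isPropagator_propagator H₀ H₁ u).isPrimitiveOn_star_mul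
    (isPropagator_propagator H₀ H₁ v) (controlAffine_mem_skewAdjoint h₀ h₁ u)).2 t ht
  simp only [(isPropagator_propagator H₀ H₁ _).1, star_one, mul_one,
    intervalIntegral.integral_of_le ht.1] at hduhamel
  rw [hduhamel]
  have hsub : Ioc 0 t ⊆ Icc 0 T := Ioc_subset_Icc_self.trans (Icc_subset_Icc_right ht.2)
  congr 1
  refine integral_congr_ae ?_
  filter_upwards [ae_restrict_of_ae_restrict_of_subset hsub (Lp.coeFn_sub v u)] with s hs
  rw [hs, Pi.sub_apply, add_sub_add_left_eq_sub, ← sub_smul, mul_smul_comm, smul_mul_assoc,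
    interactionPicture]

theorem logDeriv_mem_skewAdjoint (H₀ : A) (h₁ : H₁ ∈ skewAdjoint A) (u w : Control T) :
    logDeriv H₀ H₁ u w ∈ skewAdjoint A := by
  rw [skewAdjoint.mem_iff, logDeriv, controlIntegral_apply, ← integral_neg]
  refine ((starL' ℝ : A ≃L[ℝ] A).integral_comp_comm _).symm.trans
    (integral_congr_ae (.of_forall fun t => ?_))
  exact skewAdjoint.mem_iff.1 (skewAdjoint.smul_mem _ (skewAdjoint.conjugate' h₁ _))

variable [IsDedekindFiniteMonoid A]

theorem propagator_mem_unitary (h₀ : H₀ ∈ skewAdjoint A) (h₁ : H₁ ∈ skewAdjoint A)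
    (u : Control T) (ht : t ∈ Icc 0 T) : propagator H₀ H₁ u t ∈ unitary A :=
  (isPropagator_propagator H₀ H₁ u).mem_unitary (controlAffine_mem_skewAdjoint h₀ h₁ u) ht

theorem propagator_sub_propagator (h₀ : H₀ ∈ skewAdjoint A) (h₁ : H₁ ∈ skewAdjoint A)
    (u v : Control T) (ht : t ∈ Icc 0 T) :
    propagator H₀ H₁ v t - propagator H₀ H₁ u t = propagator H₀ H₁ u t * ∫ s in Ioc 0 t,
      (v - u) s • interactionPicture H₀ H₁ u v s := by
  have hunitary := (propagator_mem_unitary h₀ h₁ u ht).2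
  rw [← sub_eq_iff_eq_add'.2 (star_propagator_mul_propagator h₀ h₁ u v ht), mul_sub, ← mul_assoc,
    hunitary, one_mul, mul_one]

end ControlAffine

section Sensitivity

variable {A : Type*} [NormedRing A]

/-- A bound for the norm of `w ↦ ∫ w s • U(s)† H₁ U(s) ds`, and for the Lipschitz constant of
`u ↦ U(t)` up to a factor `c`, when unitaries have norm at most `c`. It does not involve the
drift `H₀`. -/
def sensitivity (c T : ℝ) (H₁ : A) : ℝ := c ^ 2 * ‖H₁‖ * √T

theorem sensitivity_nonneg (c T : ℝ) (H₁ : A) : 0 ≤ sensitivity c T H₁ := by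
  unfold sensitivity
  positivity

theorem norm_commutator_le (X Y : A) : ‖X * Y - Y * X‖ ≤ 2 * ‖Y‖ * ‖X‖ := by
  calc _ ≤ ‖X‖ * ‖Y‖ + ‖Y‖ * ‖X‖ :=
        (norm_sub_le _ _).trans (add_le_add (norm_mul_le _ _) (norm_mul_le _ _))
    _ = _ := by ring

theorem norm_conj_sub_conj_le [StarRing A] [NormedStarGroup A] {U V X Y : A} {c : ℝ}
    (hU : ‖U‖ ≤ c) (hV : ‖V‖ ≤ c) :
    ‖U * X * star U - V * Y * star V‖ ≤ 2 * c * ‖X‖ * ‖U - V‖ + c ^ 2 * ‖X - Y‖ := by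
  have hc : 0 ≤ c := (norm_nonneg U).trans hU
  calc ‖U * X * star U - V * Y * star V‖
      = ‖(U - V) * X * star U + V * X * star (U - V) + V * (X - Y) * star V‖ := by
        rw [star_sub]
        congr 1
        noncomm_ring
    _ ≤ ‖U - V‖ * ‖X‖ * c + c * ‖X‖ * ‖U - V‖ + c * ‖X - Y‖ * c := by
        refine norm_add₃_le.trans (add_le_add_three ?_ ?_ ?_) <;>
          refine norm_mul₃_le.trans ?_ <;> rw [norm_star] <;> gcongr
    _ = 2 * c * ‖X‖ * ‖U - V‖ + c ^ 2 * ‖X - Y‖ := by ring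

theorem norm_star_mul_mul_le [StarRing A] [NormedStarGroup A] {U V X : A} {a b : ℝ}
    (hU : ‖U‖ ≤ a) (hV : ‖V‖ ≤ b) : ‖star U * X * V‖ ≤ a * ‖X‖ * b := by
  have ha : 0 ≤ a := (norm_nonneg U).trans hU
  refine norm_mul₃_le.trans ?_
  rw [norm_star]
  gcongr

variable [NormedAlgebra ℝ A] [CompleteSpace A] [StarRing A] [StarModule ℝ A] [NormedStarGroup A]
  [IsDedekindFiniteMonoid A] {T t c : ℝ} {H₀ H₁ : A}

theorem norm_interactionPicture_le (hc : ∀ U ∈ unitary A, ‖U‖ ≤ c) (h₀ : H₀ ∈ skewAdjoint A)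
    (h₁ : H₁ ∈ skewAdjoint A) (u v : Control T) (ht : t ∈ Icc 0 T) :
    ‖interactionPicture H₀ H₁ u v t‖ ≤ c ^ 2 * ‖H₁‖ :=
  (norm_star_mul_mul_le (hc _ (propagator_mem_unitary h₀ h₁ u ht))
    (hc _ (propagator_mem_unitary h₀ h₁ v ht))).trans_eq (by ring)

theorem norm_propagator_sub_le (hc : ∀ U ∈ unitary A, ‖U‖ ≤ c) (h₀ : H₀ ∈ skewAdjoint A)
    (h₁ : H₁ ∈ skewAdjoint A) (u v : Control T) (ht : t ∈ Icc 0 T) :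
    ‖propagator H₀ H₁ v t - propagator H₀ H₁ u t‖ ≤ c * sensitivity c T H₁ * ‖v - u‖ := by
  have hnorm : ∀ (w : Control T), ∀ s ∈ Icc 0 T, ‖propagator H₀ H₁ w s‖ ≤ c := fun w s hs =>
    hc _ (propagator_mem_unitary h₀ h₁ w hs)
  have hc0 : 0 ≤ c := (norm_nonneg _).trans (hnorm u t ht)
  have hsub : Ioc 0 t ⊆ Icc 0 T := Ioc_subset_Icc_self.trans (Icc_subset_Icc_right ht.2)
  rw [propagator_sub_propagator h₀ h₁ u v ht, mul_assoc]
  refine (norm_mul_le _ _).trans (mul_le_mul (hnorm u t ht) ?_ (norm_nonneg _) hc0)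
  refine (norm_setIntegral_control_smul_le (v - u) measurableSet_Ioc hsub (by positivity)
    fun s hs => norm_interactionPicture_le hc h₀ h₁ u v hs).trans_eq ?_
  rw [sensitivity]

theorem norm_interactionPicture_sub_le (hc : ∀ U ∈ unitary A, ‖U‖ ≤ c) (h₀ : H₀ ∈ skewAdjoint A)
    (h₁ : H₁ ∈ skewAdjoint A) (u v : Control T) (ht : t ∈ Icc 0 T) :
    ‖interactionPicture H₀ H₁ u u t - interactionPicture H₀ H₁ v v t‖ ≤
      2 * c ^ 2 * ‖H₁‖ * sensitivity c T H₁ * ‖u - v‖ := by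
  have hnorm : ∀ w : Control T, ‖star (propagator H₀ H₁ w t)‖ ≤ c := fun w => by
    rw [norm_star]
    exact hc _ (propagator_mem_unitary h₀ h₁ w ht)
  have hc0 : 0 ≤ c := (norm_nonneg _).trans (hnorm u)
  have hconj := norm_conj_sub_conj_le (X := H₁) (Y := H₁) (hnorm u) (hnorm v)
  rw [star_star, star_star, sub_self, norm_zero, mul_zero, add_zero, ← star_sub, norm_star]
    at hconj
  calc _ ≤ 2 * c * ‖H₁‖ * ‖propagator H₀ H₁ u t - propagator H₀ H₁ v t‖ := hconj
    _ ≤ 2 * c * ‖H₁‖ * (c * sensitivity c T H₁ * ‖u - v‖) := by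
        gcongr
        exact norm_propagator_sub_le hc h₀ h₁ v u ht
    _ = _ := by ring

theorem norm_logDeriv_le (hc : ∀ U ∈ unitary A, ‖U‖ ≤ c) (h₀ : H₀ ∈ skewAdjoint A)
    (h₁ : H₁ ∈ skewAdjoint A) (u : Control T) : ‖logDeriv H₀ H₁ u‖ ≤ sensitivity c T H₁ :=
  norm_controlIntegral_le _ (by positivity) fun _ ht => norm_interactionPicture_le hc h₀ h₁ u u ht

theorem norm_logDeriv_sub_le (hc : ∀ U ∈ unitary A, ‖U‖ ≤ c) (h₀ : H₀ ∈ skewAdjoint A)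
    (h₁ : H₁ ∈ skewAdjoint A) (u v : Control T) :
    ‖logDeriv H₀ H₁ u - logDeriv H₀ H₁ v‖ ≤ 2 * sensitivity c T H₁ ^ 2 * ‖u - v‖ := by
  have hS := sensitivity_nonneg c T H₁
  rw [logDeriv, logDeriv, ← controlIntegral_sub]
  refine (norm_controlIntegral_le _ (by positivity) fun t ht =>
    norm_interactionPicture_sub_le hc h₀ h₁ u v ht).trans_eq ?_
  rw [sensitivity]
  ring

theorem norm_propagator_sub_sub_logDeriv_le (hT : 0 ≤ T) (hc : ∀ U ∈ unitary A, ‖U‖ ≤ c)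
    (h₀ : H₀ ∈ skewAdjoint A) (h₁ : H₁ ∈ skewAdjoint A) (u v : Control T) :
    ‖propagator H₀ H₁ v T - propagator H₀ H₁ u T -
      propagator H₀ H₁ u T * logDeriv H₀ H₁ u (v - u)‖ ≤
        c * sensitivity c T H₁ ^ 2 * ‖v - u‖ ^ 2 := by
  have hT' : T ∈ Icc 0 T := right_mem_Icc.2 hT
  have hnorm : ∀ t ∈ Icc 0 T, ‖propagator H₀ H₁ u t‖ ≤ c := fun t ht =>
    hc _ (propagator_mem_unitary h₀ h₁ u ht)
  have hc0 : 0 ≤ c := (norm_nonneg _).trans (hnorm T hT')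
  have hS := sensitivity_nonneg c T H₁
  have hremainder : propagator H₀ H₁ v T - propagator H₀ H₁ u T -
      propagator H₀ H₁ u T * logDeriv H₀ H₁ u (v - u) =
        propagator H₀ H₁ u T * controlIntegral
          ((continuousOn_interactionPicture H₀ H₁ u v).sub
            (continuousOn_interactionPicture H₀ H₁ u u)) (v - u) := by
    rw [propagator_sub_propagator h₀ h₁ u v hT', ← integral_Icc_eq_integral_Ioc, ← mul_sub,
      controlIntegral_sub (continuousOn_interactionPicture H₀ H₁ u v)
        (continuousOn_interactionPicture H₀ H₁ u u)]
    rfl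
  rw [hremainder]
  have hintegrand : ∀ t ∈ Icc 0 T,
      ‖interactionPicture H₀ H₁ u v t - interactionPicture H₀ H₁ u u t‖ ≤
        c * ‖H₁‖ * (c * sensitivity c T H₁ * ‖v - u‖) := fun t ht => by
    rw [interactionPicture, interactionPicture, ← mul_sub]
    exact norm_star_mul_mul_le (hnorm t ht) (norm_propagator_sub_le hc h₀ h₁ u v ht)
  calc _ ≤ c * (c * ‖H₁‖ * (c * sensitivity c T H₁ * ‖v - u‖) * √T * ‖v - u‖) :=
        (norm_mul_le _ _).trans (mul_le_mul (hnorm T hT') (ContinuousLinearMap.le_of_opNorm_le _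
          (norm_controlIntegral_le _ (by positivity) hintegrand) _) (norm_nonneg _) hc0)
    _ = c * sensitivity c T H₁ ^ 2 * ‖v - u‖ ^ 2 := by
        rw [pow_two (sensitivity c T H₁)]
        nth_rw 3 [sensitivity]
        ring

theorem hasFDerivAt_propagator (hT : 0 ≤ T) (hc : ∀ U ∈ unitary A, ‖U‖ ≤ c)
    (h₀ : H₀ ∈ skewAdjoint A) (h₁ : H₁ ∈ skewAdjoint A) (u : Control T) :
    HasFDerivAt (fun v => propagator H₀ H₁ v T)
      (ContinuousLinearMap.mul ℝ A (propagator H₀ H₁ u T) ∘L logDeriv H₀ H₁ u) u := by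
  refine .of_isLittleO (Asymptotics.IsBigO.trans_isLittleO (g := fun v => ‖v - u‖ ^ 2) ?_ ?_)
  · refine .of_bound (c * sensitivity c T H₁ ^ 2) (.of_forall fun v => ?_)
    rw [norm_pow, norm_norm]
    exact norm_propagator_sub_sub_logDeriv_le hT hc h₀ h₁ u v
  · exact Asymptotics.isLittleO_pow_sub_sub u one_lt_two

theorem hasFDerivAt_conj_propagator (hT : 0 ≤ T) (hc : ∀ U ∈ unitary A, ‖U‖ ≤ c)
    (h₀ : H₀ ∈ skewAdjoint A) (h₁ : H₁ ∈ skewAdjoint A) (ρ₀ : A) (u : Control T) :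
    HasFDerivAt (fun v => propagator H₀ H₁ v T * ρ₀ * star (propagator H₀ H₁ v T))
      (endDeriv H₀ H₁ ρ₀ u) u := by
  have hU := hasFDerivAt_propagator hT hc h₀ h₁ u
  refine ((hU.mul_const' ρ₀).mul' hU.star).congr_fderiv ?_
  ext w
  have hskew := skewAdjoint.mem_iff.1 (logDeriv_mem_skewAdjoint H₀ h₁ u w)
  simp only [add_apply, smul_apply, ContinuousLinearMap.comp_apply, ContinuousLinearMap.mul_apply',
    ContinuousLinearEquiv.coe_coe, starL'_apply, star_mul, hskew, neg_mul, mul_neg, smul_eq_mul,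
    MulOpposite.smul_eq_mul_unop, MulOpposite.unop_op, endDeriv_apply]
  noncomm_ring

theorem norm_commutator_logDeriv_le (hc : ∀ U ∈ unitary A, ‖U‖ ≤ c) (h₀ : H₀ ∈ skewAdjoint A)
    (h₁ : H₁ ∈ skewAdjoint A) (ρ₀ : A) (u w : Control T) :
    ‖logDeriv H₀ H₁ u w * ρ₀ - ρ₀ * logDeriv H₀ H₁ u w‖ ≤
      2 * ‖ρ₀‖ * sensitivity c T H₁ * ‖w‖ := by
  refine (norm_commutator_le _ _).trans ?_
  rw [mul_assoc _ (sensitivity c T H₁)]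
  gcongr
  exact ContinuousLinearMap.le_of_opNorm_le _ (norm_logDeriv_le hc h₀ h₁ u) w

theorem norm_endDeriv_le (hT : 0 ≤ T) (hc : ∀ U ∈ unitary A, ‖U‖ ≤ c) (h₀ : H₀ ∈ skewAdjoint A)
    (h₁ : H₁ ∈ skewAdjoint A) (ρ₀ : A) (u : Control T) :
    ‖endDeriv H₀ H₁ ρ₀ u‖ ≤ 2 * c ^ 2 * ‖ρ₀‖ * sensitivity c T H₁ := by
  have hU : ‖propagator H₀ H₁ u T‖ ≤ c :=
    hc _ (propagator_mem_unitary h₀ h₁ u (right_mem_Icc.2 hT))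
  have hS := sensitivity_nonneg c T H₁
  refine ContinuousLinearMap.opNorm_le_bound _ (by positivity) fun w => ?_
  have hUstar : ‖star (propagator H₀ H₁ u T)‖ ≤ c := (norm_star _).trans_le hU
  rw [endDeriv_apply]
  nth_rw 1 [← star_star (propagator H₀ H₁ u T)]
  calc _ ≤ c * (2 * ‖ρ₀‖ * sensitivity c T H₁ * ‖w‖) * c := by
        have hc0 : 0 ≤ c := (norm_nonneg _).trans hU
        refine (norm_star_mul_mul_le hUstar hUstar).trans ?_
        gcongr
        exact norm_commutator_logDeriv_le hc h₀ h₁ ρ₀ u w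
    _ = _ := by ring

theorem norm_endDeriv_sub_le (hT : 0 ≤ T) (hc : ∀ U ∈ unitary A, ‖U‖ ≤ c)
    (h₀ : H₀ ∈ skewAdjoint A) (h₁ : H₁ ∈ skewAdjoint A) (ρ₀ : A) (u v : Control T) :
    ‖endDeriv H₀ H₁ ρ₀ u - endDeriv H₀ H₁ ρ₀ v‖ ≤
      8 * c ^ 2 * ‖ρ₀‖ * sensitivity c T H₁ ^ 2 * ‖u - v‖ := by
  have hT' : T ∈ Icc 0 T := right_mem_Icc.2 hT
  have hnorm : ∀ w : Control T, ‖propagator H₀ H₁ w T‖ ≤ c := fun w =>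
    hc _ (propagator_mem_unitary h₀ h₁ w hT')
  have hc0 : 0 ≤ c := (norm_nonneg _).trans (hnorm u)
  have hS := sensitivity_nonneg c T H₁
  refine ContinuousLinearMap.opNorm_le_bound _ (by positivity) fun w => ?_
  have hcomm : ‖(logDeriv H₀ H₁ u w * ρ₀ - ρ₀ * logDeriv H₀ H₁ u w) -
      (logDeriv H₀ H₁ v w * ρ₀ - ρ₀ * logDeriv H₀ H₁ v w)‖ ≤
        2 * ‖ρ₀‖ * (2 * sensitivity c T H₁ ^ 2 * ‖u - v‖ * ‖w‖) := by
    rw [sub_sub_sub_comm, ← sub_mul, ← mul_sub, ← sub_apply]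
    refine (norm_commutator_le _ _).trans ?_
    gcongr
    exact ContinuousLinearMap.le_of_opNorm_le _ (norm_logDeriv_sub_le hc h₀ h₁ u v) w
  rw [sub_apply, endDeriv_apply, endDeriv_apply]
  calc _ ≤ 2 * c * (2 * ‖ρ₀‖ * sensitivity c T H₁ * ‖w‖) * (c * sensitivity c T H₁ * ‖u - v‖) +
        c ^ 2 * (2 * ‖ρ₀‖ * (2 * sensitivity c T H₁ ^ 2 * ‖u - v‖ * ‖w‖)) := by
        refine (norm_conj_sub_conj_le (hnorm u) (hnorm v)).trans ?_
        gcongr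
        · exact norm_commutator_logDeriv_le hc h₀ h₁ ρ₀ u w
        · exact norm_propagator_sub_le hc h₀ h₁ v u hT'
    _ = _ := by ring

theorem exists_forall_norm_comp_endDeriv_le (hT : 0 ≤ T) (hc : ∀ U ∈ unitary A, ‖U‖ ≤ c)
    (h₁ : H₁ ∈ skewAdjoint A) (ρ₀ : A) (φ : StrongDual ℝ A) :
    ∃ C, ∀ H₀ ∈ skewAdjoint A, ∀ u : Control T, ‖φ.comp (endDeriv H₀ H₁ ρ₀ u)‖ ≤ C := by
  refine ⟨‖φ‖ * (2 * c ^ 2 * ‖ρ₀‖ * sensitivity c T H₁), fun H₀ h₀ u => ?_⟩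
  refine (ContinuousLinearMap.opNorm_comp_le _ _).trans ?_
  gcongr
  exact norm_endDeriv_le hT hc h₀ h₁ ρ₀ u

theorem exists_lipschitzWith_comp_endDeriv (hT : 0 ≤ T) (hc : ∀ U ∈ unitary A, ‖U‖ ≤ c)
    (h₀ : H₀ ∈ skewAdjoint A) (h₁ : H₁ ∈ skewAdjoint A) (ρ₀ : A) (φ : StrongDual ℝ A) :
    ∃ K, LipschitzWith K fun u : Control T => φ.comp (endDeriv H₀ H₁ ρ₀ u) := by
  refine ⟨_, LipschitzWith.of_dist_le'
    (K := ‖φ‖ * (8 * c ^ 2 * ‖ρ₀‖ * sensitivity c T H₁ ^ 2)) fun u v => ?_⟩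
  rw [dist_eq_norm, dist_eq_norm, ← ContinuousLinearMap.comp_sub, mul_assoc]
  refine (ContinuousLinearMap.opNorm_comp_le _ _).trans ?_
  gcongr
  exact norm_endDeriv_sub_le hT hc h₀ h₁ ρ₀ u v

end Sensitivity

section GlobalFlow

variable {X : Type*} [NormedAddCommGroup X] [NormedSpace ℝ X] {F : X → X} {K : ℝ≥0} {b C : ℝ}
  {f g : ℝ → X}

theorem eqOn_Icc_of_isIntegralCurveOn (hF : LipschitzWith K F)
    (hf : IsIntegralCurveOn f (fun _ => F) (Icc 0 b))
    (hg : IsIntegralCurveOn g (fun _ => F) (Icc 0 b)) (h0 : f 0 = g 0) : EqOn f g (Icc 0 b) := by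
  have hright : ∀ {h : ℝ → X}, IsIntegralCurveOn h (fun _ => F) (Icc 0 b) →
      ∀ t ∈ Ico 0 b, HasDerivWithinAt h (F (h t)) (Ici t) t := fun hh t ht =>
    ((hh t (Ico_subset_Icc_self ht)).mono (Icc_subset_Icc_left ht.1)).mono_of_mem_nhdsWithin
      (Icc_mem_nhdsGE ht.2)
  exact ODE_solution_unique (fun _ => hF) hf.continuousOn (hright hf) hg.continuousOn (hright hg) h0

variable [CompleteSpace X]

theorem exists_isIntegralCurveOn_Icc (hC : ∀ x, ‖F x‖ ≤ C) (hF : LipschitzWith K F) (x₀ : X)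
    (hb : 0 ≤ b) : ∃ P : ℝ → X, P 0 = x₀ ∧ IsIntegralCurveOn P (fun _ => F) (Icc 0 b) := by
  lift C to ℝ≥0 using (norm_nonneg _).trans (hC x₀)
  lift b to ℝ≥0 using hb
  have hPicard : IsPicardLindelof (fun _ => F) (⟨0, le_rfl, b.2⟩ : Icc (0 : ℝ) b) x₀ (C * b) 0
      C K := by
    refine .of_time_independent (fun x _ => hC x) hF.lipschitzOnWith ?_
    simp only [sub_zero, sub_self, max_eq_left (NNReal.coe_nonneg _), NNReal.coe_zero,
      NNReal.coe_mul, le_refl]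
  exact hPicard.exists_eq_forall_mem_Icc_hasDerivWithinAt₀

theorem exists_isIntegralCurveOn_Ici (hC : ∀ x, ‖F x‖ ≤ C) (hF : LipschitzWith K F) (x₀ : X) :
    ∃ P : ℝ → X, P 0 = x₀ ∧ IsIntegralCurveOn P (fun _ => F) (Ici 0) := by
  choose G hG0 hG using fun N : ℕ =>
    exists_isIntegralCurveOn_Icc hC hF x₀ (b := (N : ℝ) + 1) (by positivity)
  have hglue : ∀ N : ℕ, EqOn (fun s => G ⌊s⌋₊ s) (G N) (Icc 0 (N + 1)) := fun N s hs =>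
    eqOn_Icc_of_isIntegralCurveOn hF
      ((hG ⌊s⌋₊).mono (Icc_subset_Icc_right (Nat.lt_floor_add_one s).le))
      ((hG N).mono (Icc_subset_Icc_right hs.2)) ((hG0 _).trans (hG0 _).symm) ⟨hs.1, le_rfl⟩
  refine ⟨fun s => G ⌊s⌋₊ s, hG0 _, fun s hs => ?_⟩
  have hlt := Nat.lt_floor_add_one s
  have hderiv := (hG ⌊s⌋₊ s ⟨hs, hlt.le⟩).congr (hglue ⌊s⌋₊) rfl
  refine hderiv.mono_of_mem_nhdsWithin ?_
  rw [← Ici_inter_Iic]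
  exact inter_mem_nhdsWithin _ (Iic_mem_nhds hlt)

theorem exists_isIntegralCurveOn_Ici_forall_eqOn (hC : ∀ x, ‖F x‖ ≤ C) (hF : LipschitzWith K F)
    (x₀ : X) : ∃ P : ℝ → X, (P 0 = x₀ ∧ IsIntegralCurveOn P (fun _ => F) (Ici 0)) ∧
      ∀ I : Set ℝ, I.OrdConnected → 0 ∈ I → I ⊆ Ici 0 → ∀ Q : ℝ → X,
        (Q 0 = x₀ ∧ IsIntegralCurveOn Q (fun _ => F) I) → EqOn Q P I := by
  obtain ⟨P, hP0, hP⟩ := exists_isIntegralCurveOn_Ici hC hF x₀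
  refine ⟨P, ⟨hP0, hP⟩, fun I hI h0 hI0 Q ⟨hQ0, hQ⟩ s hs => ?_⟩
  exact eqOn_Icc_of_isIntegralCurveOn hF (hQ.mono (hI.out h0 hs)) (hP.mono Icc_subset_Ici_self)
    (hQ0.trans hP0.symm) ⟨hI0 hs, le_rfl⟩

end GlobalFlow

section Trajectory

variable {n : ℕ} {T t : ℝ} {H₀ H₁ ρ₀ : Mat n} {u : Control T} {ρ : ℝ → Mat n}

theorem IsTrajectory.apply_zero (hρ : IsTrajectory H₀ H₁ ρ₀ u ρ) (hT : 0 ≤ T) : ρ 0 = ρ₀ := by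
  rw [hρ.2 0 (left_mem_Icc.2 hT), intervalIntegral.integral_same, add_zero]

theorem IsTrajectory.isPrimitiveOn (hρ : IsTrajectory H₀ H₁ ρ₀ u ρ) (hT : 0 ≤ T) :
    IsPrimitiveOn ρ (fun t => (H₀ + u t • H₁) * ρ t - ρ t * (H₀ + u t • H₁)) 0 T := by
  have hX := integrableOn_controlAffine H₀ H₁ u
  refine ⟨(hX.mul_continuousOn hρ.1 isCompact_Icc).sub (hX.continuousOn_mul hρ.1 isCompact_Icc),
    fun t ht => ?_⟩
  rw [hρ.apply_zero hT]
  exact hρ.2 t ht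

theorem IsTrajectory.eq_conj_propagator (hρ : IsTrajectory H₀ H₁ ρ₀ u ρ)
    (h₀ : H₀ ∈ skewAdjoint (Mat n)) (h₁ : H₁ ∈ skewAdjoint (Mat n)) (ht : t ∈ Icc 0 T) :
    ρ t = propagator H₀ H₁ u t * ρ₀ * star (propagator H₀ H₁ u t) := by
  have hT : 0 ≤ T := ht.1.trans ht.2
  rw [← hρ.apply_zero hT]
  exact (isPropagator_propagator H₀ H₁ u).eq_conj_of_isPrimitiveOn
    (controlAffine_mem_skewAdjoint h₀ h₁ u) (hρ.isPrimitiveOn hT) ht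

theorem isTrajectory_conj_propagator (h₀ : H₀ ∈ skewAdjoint (Mat n))
    (h₁ : H₁ ∈ skewAdjoint (Mat n)) (ρ₀ : Mat n) (u : Control T) :
    IsTrajectory H₀ H₁ ρ₀ u
      (fun t => propagator H₀ H₁ u t * ρ₀ * star (propagator H₀ H₁ u t)) := by
  have hconj := (isPropagator_propagator H₀ H₁ u).isPrimitiveOn_conj
    (controlAffine_mem_skewAdjoint h₀ h₁ u) ρ₀
  refine ⟨hconj.continuousOn, fun t ht => ?_⟩
  refine (hconj.2 t ht).trans ?_
  simp only [(isPropagator_propagator H₀ H₁ u).1, star_one, mul_one, one_mul]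

theorem exists_isTrajectory_forall_eqOn (h₀ : H₀ ∈ skewAdjoint (Mat n))
    (h₁ : H₁ ∈ skewAdjoint (Mat n)) (ρ₀ : Mat n) (u : Control T) :
    ∃ ρ, IsTrajectory H₀ H₁ ρ₀ u ρ ∧ ∀ ρ', IsTrajectory H₀ H₁ ρ₀ u ρ' → EqOn ρ' ρ (Icc 0 T) :=
  ⟨_, isTrajectory_conj_propagator h₀ h₁ ρ₀ u, fun _ hρ' _ ht => hρ'.eq_conj_propagator h₀ h₁ ht⟩

theorem endPoint_eq_conj_propagator (hT : 0 ≤ T) (h₀ : H₀ ∈ skewAdjoint (Mat n))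
    (h₁ : H₁ ∈ skewAdjoint (Mat n)) (ρ₀ : Mat n) (u : Control T) :
    endPoint H₀ H₁ ρ₀ u = propagator H₀ H₁ u T * ρ₀ * star (propagator H₀ H₁ u T) := by
  have hex : ∃ ρ, IsTrajectory H₀ H₁ ρ₀ u ρ := ⟨_, isTrajectory_conj_propagator h₀ h₁ ρ₀ u⟩
  rw [endPoint, dif_pos hex]
  exact hex.choose_spec.eq_conj_propagator h₀ h₁ (right_mem_Icc.2 hT)

end Trajectory

section Orbit

variable {n : ℕ} {T : ℝ} {H₀ H₁ : Mat n}

theorem exists_forall_norm_unitary_le (n : ℕ) : ∃ c, ∀ U ∈ unitary (Mat n), ‖U‖ ≤ c := by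
  refine ⟨(∑ _i : Fin n, ∑ _j : Fin n, (1 : ℝ)) ^ (1 / 2 : ℝ), fun U hU => ?_⟩
  rw [Matrix.frobenius_norm_def]
  gcongr with i _ j _
  exact Real.rpow_le_one (norm_nonneg _) (entry_norm_bound_of_unitary hU i j) zero_le_two

theorem exists_smul_mem_specialUnitaryGroup {m : Type*} [Fintype m] [DecidableEq m]
    {U : Matrix m m ℂ} (hU : U ∈ Matrix.unitaryGroup m ℂ) :
    ∃ c ∈ unitary ℂ, c • U ∈ Matrix.specialUnitaryGroup m ℂ := by
  rcases isEmpty_or_nonempty m with hm | hm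
  · exact ⟨1, one_mem _, Matrix.mem_specialUnitaryGroup_iff.2
      ⟨by rwa [one_smul], Matrix.det_isEmpty⟩⟩
  have hdet : U.det ∈ unitary ℂ := Matrix.det_of_mem_unitary hU
  have hdet_norm : ‖U.det‖ = 1 := CStarRing.norm_of_mem_unitary hdet
  obtain ⟨c, hc⟩ := IsAlgClosed.exists_pow_nat_eq (U.det)⁻¹ (Fintype.card_pos (α := m))
  have hc_norm : ‖c‖ = 1 := by
    have hpow := congrArg norm hc
    rw [norm_pow, norm_inv, hdet_norm, inv_one] at hpow
    exact (pow_eq_one_iff_of_nonneg (norm_nonneg c) Fintype.card_ne_zero).1 hpow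
  have hc_unitary : c ∈ unitary ℂ := by
    rw [Unitary.mem_iff_self_mul_star, Complex.star_def, Complex.mul_conj', hc_norm]
    norm_num
  refine ⟨c, hc_unitary, Matrix.mem_specialUnitaryGroup_iff.2 ⟨?_, ?_⟩⟩
  · exact Unitary.smul_mem_of_mem hc_unitary hU
  · rw [Matrix.det_smul, hc, inv_mul_cancel₀ (norm_ne_zero_iff.1 (hdet_norm ▸ one_ne_zero))]

theorem conj_mem_unitaryOrbit (ρ₀ : Mat n) {U : Mat n} (hU : U ∈ unitary (Mat n)) :
    U * ρ₀ * star U ∈ unitaryOrbit ρ₀ := by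
  obtain ⟨c, hc, hcU⟩ := exists_smul_mem_specialUnitaryGroup hU
  refine ⟨c • U, hcU, ?_⟩
  rw [← Matrix.star_eq_conjTranspose, star_smul, smul_mul_assoc, smul_mul_smul_comm, hc.2, one_smul]

theorem sub_trace_smul_one_mem_su {Ω : Mat n} (hΩ : Ω ∈ skewAdjoint (Mat n)) :
    Ω - (Ω.trace / n) • (1 : Mat n) ∈ su n := by
  have hΩ' : Ωᴴ = -Ω := hΩ
  have htrace : star (Ω.trace / n) = -(Ω.trace / n) := by
    rw [star_div₀, ← Matrix.trace_conjTranspose, hΩ', Matrix.trace_neg, star_natCast, neg_div]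
  constructor
  · rw [Matrix.conjTranspose_sub, Matrix.conjTranspose_smul, hΩ', htrace,
      Matrix.conjTranspose_one, neg_smul]
    abel
  · rw [Matrix.trace_sub, Matrix.trace_smul, Matrix.trace_one, Fintype.card_fin, smul_eq_mul]
    rcases Nat.eq_zero_or_pos n with rfl | hn
    · simp [Matrix.trace]
    · rw [div_mul_cancel₀ _ (Nat.cast_ne_zero.2 hn.ne'), sub_self]

theorem commutator_mem_tangentSpace (ρ : Mat n) {Ω : Mat n} (hΩ : Ω ∈ skewAdjoint (Mat n)) :
    Ω * ρ - ρ * Ω ∈ tangentSpace ρ := by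
  refine ⟨_, sub_trace_smul_one_mem_su (neg_mem hΩ), ?_⟩
  change ρ * (-Ω - _ • (1 : Mat n)) - (-Ω - _ • (1 : Mat n)) * ρ = Ω * ρ - ρ * Ω
  simp only [mul_sub, sub_mul, mul_smul_comm, smul_mul_assoc, mul_one, one_mul, mul_neg, neg_mul]
  abel

theorem endPoint_mem_unitaryOrbit (hT : 0 ≤ T) (h₀ : H₀ ∈ skewAdjoint (Mat n))
    (h₁ : H₁ ∈ skewAdjoint (Mat n)) (ρ₀ : Mat n) (u : Control T) :
    endPoint H₀ H₁ ρ₀ u ∈ unitaryOrbit ρ₀ := by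
  rw [endPoint_eq_conj_propagator hT h₀ h₁]
  exact conj_mem_unitaryOrbit ρ₀ (propagator_mem_unitary h₀ h₁ u (right_mem_Icc.2 hT))

theorem hasFDerivAt_endPoint (hT : 0 ≤ T) (h₀ : H₀ ∈ skewAdjoint (Mat n))
    (h₁ : H₁ ∈ skewAdjoint (Mat n)) (ρ₀ : Mat n) (u : Control T) :
    HasFDerivAt (fun w : Control T => endPoint H₀ H₁ ρ₀ w) (endDeriv H₀ H₁ ρ₀ u) u := by
  obtain ⟨c, hc⟩ := exists_forall_norm_unitary_le n
  simp only [endPoint_eq_conj_propagator hT h₀ h₁]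
  exact hasFDerivAt_conj_propagator hT hc h₀ h₁ ρ₀ u

theorem dEnd_eq_endDeriv (hT : 0 ≤ T) (h₀ : H₀ ∈ skewAdjoint (Mat n))
    (h₁ : H₁ ∈ skewAdjoint (Mat n)) (ρ₀ : Mat n) (u : Control T) :
    dEnd H₀ H₁ ρ₀ u = endDeriv H₀ H₁ ρ₀ u :=
  (hasFDerivAt_endPoint hT h₀ h₁ ρ₀ u).fderiv

theorem dEnd_mem_tangentSpace (hT : 0 ≤ T) (h₀ : H₀ ∈ skewAdjoint (Mat n))
    (h₁ : H₁ ∈ skewAdjoint (Mat n)) (ρ₀ : Mat n) (u w : Control T) :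
    dEnd H₀ H₁ ρ₀ u w ∈ tangentSpace (endPoint H₀ H₁ ρ₀ u) := by
  rw [dEnd_eq_endDeriv hT h₀ h₁, endPoint_eq_conj_propagator hT h₀ h₁]
  set U := propagator H₀ H₁ u T
  have hunitary : star U * U = 1 := (propagator_mem_unitary h₀ h₁ u (right_mem_Icc.2 hT)).1
  set Ω := logDeriv H₀ H₁ u w
  have hcommutator : endDeriv H₀ H₁ ρ₀ u w =
      U * Ω * star U * (U * ρ₀ * star U) - U * ρ₀ * star U * (U * Ω * star U) := by
    calc _ = U * Ω * (star U * U) * ρ₀ * star U - U * ρ₀ * (star U * U) * Ω * star U := by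
          rw [hunitary, endDeriv_apply]
          noncomm_ring
      _ = _ := by simp only [mul_assoc]
  have hskew := skewAdjoint.conjugate (logDeriv_mem_skewAdjoint H₀ h₁ u w) U
  exact hcommutator ▸ commutator_mem_tangentSpace (U * ρ₀ * star U) hskew

end Orbit

section Metric

variable {n : ℕ}

theorem lift_mem_horizontal {ρ ξ : Mat n} (hξ : ξ ∈ tangentSpace ρ) : lift ρ ξ ∈ horizontal ρ := by
  rw [lift, dif_pos hξ]
  exact (existsUnique_lift ρ ξ hξ).choose_spec.1.1

theorem adMap_lift {ρ ξ : Mat n} (hξ : ξ ∈ tangentSpace ρ) : adMap ρ (lift ρ ξ) = ξ := by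
  rw [lift, dif_pos hξ]
  exact (existsUnique_lift ρ ξ hξ).choose_spec.1.2

theorem lift_eq_of_mem_horizontal {ρ ξ Ω : Mat n} (hξ : ξ ∈ tangentSpace ρ)
    (hΩ : Ω ∈ horizontal ρ) (hΩξ : adMap ρ Ω = ξ) : lift ρ ξ = Ω :=
  (existsUnique_lift ρ ξ hξ).unique ⟨lift_mem_horizontal hξ, adMap_lift hξ⟩ ⟨hΩ, hΩξ⟩

theorem lift_add {ρ ξ η : Mat n} (hξ : ξ ∈ tangentSpace ρ) (hη : η ∈ tangentSpace ρ) :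
    lift ρ (ξ + η) = lift ρ ξ + lift ρ η := by
  obtain ⟨hξ_su, hξ_orth⟩ := lift_mem_horizontal hξ
  obtain ⟨hη_su, hη_orth⟩ := lift_mem_horizontal hη
  refine lift_eq_of_mem_horizontal (add_mem hξ hη) ⟨add_mem hξ_su hη_su, fun Ω' hΩ' => ?_⟩ ?_
  · rw [Matrix.conjTranspose_add, Matrix.add_mul, Matrix.trace_add, hξ_orth _ hΩ', hη_orth _ hΩ',
      add_zero]
  · rw [map_add, adMap_lift hξ, adMap_lift hη]

theorem lift_smul {ρ ξ : Mat n} (c : ℝ) (hξ : ξ ∈ tangentSpace ρ) :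
    lift ρ (c • ξ) = c • lift ρ ξ := by
  obtain ⟨hξ_su, hξ_orth⟩ := lift_mem_horizontal hξ
  refine lift_eq_of_mem_horizontal (Submodule.smul_mem _ c hξ)
    ⟨Submodule.smul_mem _ c hξ_su, fun Ω' hΩ' => ?_⟩ ?_
  · rw [Matrix.conjTranspose_smul, Matrix.smul_mul, Matrix.trace_smul, hξ_orth _ hΩ', smul_zero]
  · rw [map_smul, adMap_lift hξ]

/-- The horizontal lift `ξ ↦ Ω` with `Ω ∈ 𝔭_ρ` and `[ρ, Ω] = ξ`, as a linear map. -/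
def horizontalLift (ρ : Mat n) : tangentSpace ρ →ₗ[ℝ] Mat n where
  toFun ξ := lift ρ ξ
  map_add' ξ η := lift_add ξ.2 η.2
  map_smul' c ξ := lift_smul c ξ.2

/-- The metric of the orbit as a bilinear form on the tangent space. -/
def metricForm (ρ : Mat n) : LinearMap.BilinForm ℝ (tangentSpace ρ) :=
  (hsForm n).compl₁₂ (horizontalLift ρ) (horizontalLift ρ)

theorem metricForm_apply (ρ : Mat n) (ξ η : tangentSpace ρ) : metricForm ρ ξ η = metric ρ ξ η :=
  rfl

theorem eq_zero_of_metric_self_eq_zero {ρ : Mat n} {ξ : tangentSpace ρ} (h : metric ρ ξ ξ = 0) :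
    ξ = 0 := by
  have hlift : lift ρ (ξ : Mat n) = 0 := by
    open scoped ComplexOrder in
    rw [← Matrix.trace_conjTranspose_mul_self_eq_zero_iff]
    have hnonneg := (Matrix.posSemidef_conjTranspose_mul_self (lift ρ (ξ : Mat n))).trace_nonneg
    exact Complex.ext h (Complex.nonneg_iff.1 hnonneg).2.symm
  rw [← Submodule.coe_eq_zero, ← adMap_lift ξ.2, hlift, map_zero]

theorem metricForm_bijective (ρ : Mat n) : Function.Bijective (metricForm ρ) := by
  have hinjective : Function.Injective (metricForm ρ) := by
    refine (injective_iff_map_eq_zero _).2 fun ξ hξ => eq_zero_of_metric_self_eq_zero ?_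
    rw [← metricForm_apply, hξ, LinearMap.zero_apply]
  exact ⟨hinjective, (LinearMap.injective_iff_surjective_of_finrank_eq_finrank
    Subspace.dual_finrank_eq.symm).1 hinjective⟩

/-- The cost `J` as a continuous linear functional on matrices. -/
def costCLM (θ : Mat n) : Mat n →L[ℝ] ℝ :=
  LinearMap.toContinuousLinearMap
    { toFun := costJ θ
      map_add' := fun ρ σ => by rw [costJ, Matrix.add_mul, Matrix.trace_add, Complex.add_re]; rfl
      map_smul' := fun c ρ => by
        rw [costJ, Matrix.smul_mul, Matrix.trace_smul, Complex.smul_re]; rfl }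

theorem hasFDerivAt_costJ (θ ρ : Mat n) : HasFDerivAt (costJ θ) (costCLM θ) ρ :=
  (costCLM θ).hasFDerivAt

theorem existsUnique_isGradJ (θ ρ : Mat n) : ∃! ζ, IsGradJ θ ρ ζ := by
  have hiff : ∀ ζ, IsGradJ θ ρ ζ ↔
      metricForm ρ ζ = (costCLM θ : Mat n →ₗ[ℝ] ℝ).comp (tangentSpace ρ).subtype := by
    intro ζ
    rw [IsGradJ, (hasFDerivAt_costJ θ ρ).fderiv, eq_comm, LinearMap.ext_iff]
    rfl
  simp only [hiff]
  exact (metricForm_bijective ρ).existsUnique _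

theorem isGradJ_gradJ (θ ρ : Mat n) : IsGradJ θ ρ (gradJ θ ρ) := by
  have hex := (existsUnique_isGradJ θ ρ).exists
  rw [gradJ, dif_pos hex]
  exact hex.choose_spec

end Metric

section Gradient

theorem existsUnique_linearMap_inner_eq {V H : Type*} [AddCommGroup V] [Module ℝ V]
    [NormedAddCommGroup H] [InnerProductSpace ℝ H] [CompleteSpace H] (B : V →ₗ[ℝ] H →ₗ[ℝ] ℝ)
    (hB : ∀ z, Continuous (B z)) : ∃! A : V →ₗ[ℝ] H, ∀ z v, B z v = inner ℝ (A z) v := by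
  let dual : V →ₗ[ℝ] StrongDual ℝ H :=
    { toFun := fun z => ⟨B z, hB z⟩
      map_add' := fun z w => ContinuousLinearMap.ext fun v => LinearMap.congr_fun (B.map_add z w) v
      map_smul' := fun a z =>
        ContinuousLinearMap.ext fun v => LinearMap.congr_fun (B.map_smul a z) v }
  refine ⟨(InnerProductSpace.toDual ℝ H).symm.toLinearEquiv.toLinearMap ∘ₗ dual,
    fun z v => (InnerProductSpace.toDual_symm_apply (y := dual z)).symm, fun A hA => ?_⟩
  ext1 z
  exact ext_inner_right ℝ fun v =>
    (hA z v).symm.trans (InnerProductSpace.toDual_symm_apply (y := dual z)).symm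

variable {n : ℕ} {T : ℝ} {H₀ H₁ : Mat n}

theorem existsUnique_isAdjoint (hT : 0 ≤ T) (h₀ : H₀ ∈ skewAdjoint (Mat n))
    (h₁ : H₁ ∈ skewAdjoint (Mat n)) (ρ₀ : Mat n) (u : Control T) :
    ∃! A, IsAdjoint H₀ H₁ ρ₀ u A := by
  let d : Control T →L[ℝ] tangentSpace (endPoint H₀ H₁ ρ₀ u) :=
    (dEnd H₀ H₁ ρ₀ u).codRestrict _ (dEnd_mem_tangentSpace hT h₀ h₁ ρ₀ u)
  exact existsUnique_linearMap_inner_eq ((metricForm (endPoint H₀ H₁ ρ₀ u)).compl₂ d.toLinearMap)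
    fun z => (metricForm _ z).continuous_of_finiteDimensional.comp d.continuous

theorem isAdjoint_dEndAdj (hT : 0 ≤ T) (h₀ : H₀ ∈ skewAdjoint (Mat n))
    (h₁ : H₁ ∈ skewAdjoint (Mat n)) (ρ₀ : Mat n) (u : Control T) :
    IsAdjoint H₀ H₁ ρ₀ u (dEndAdj H₀ H₁ ρ₀ u) := by
  have hex := (existsUnique_isAdjoint hT h₀ h₁ ρ₀ u).exists
  rw [dEndAdj, dif_pos hex]
  exact hex.choose_spec

theorem toDual_flowField (hT : 0 ≤ T) (h₀ : H₀ ∈ skewAdjoint (Mat n))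
    (h₁ : H₁ ∈ skewAdjoint (Mat n)) (ρ₀ θ : Mat n) (u : Control T) :
    InnerProductSpace.toDual ℝ (Control T) (flowField H₀ H₁ ρ₀ θ u) =
      (costCLM θ).comp (endDeriv H₀ H₁ ρ₀ u) := by
  rw [← dEnd_eq_endDeriv hT h₀ h₁]
  ext v
  have hgrad := isGradJ_gradJ θ (endPoint H₀ H₁ ρ₀ u)
    ⟨_, dEnd_mem_tangentSpace hT h₀ h₁ ρ₀ u v⟩
  have hadj := isAdjoint_dEndAdj hT h₀ h₁ ρ₀ u (gradJ θ (endPoint H₀ H₁ ρ₀ u)) v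
  rw [(hasFDerivAt_costJ θ _).fderiv] at hgrad
  exact (hgrad.trans hadj).symm

theorem hasGradientAt_flowField (hT : 0 ≤ T) (h₀ : H₀ ∈ skewAdjoint (Mat n))
    (h₁ : H₁ ∈ skewAdjoint (Mat n)) (ρ₀ θ : Mat n) (u : Control T) :
    HasGradientAt (fun w : Control T => costJ θ (endPoint H₀ H₁ ρ₀ w))
      (flowField H₀ H₁ ρ₀ θ u) u := by
  rw [hasGradientAt_iff_hasFDerivAt, toDual_flowField hT h₀ h₁]
  exact (hasFDerivAt_costJ θ _).comp u (hasFDerivAt_endPoint hT h₀ h₁ ρ₀ u)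

theorem exists_forall_norm_flowField_le (hT : 0 ≤ T) (h₁ : H₁ ∈ skewAdjoint (Mat n))
    (ρ₀ θ : Mat n) :
    ∃ C, ∀ H₀ ∈ skewAdjoint (Mat n), ∀ u : Control T, ‖flowField H₀ H₁ ρ₀ θ u‖ ≤ C := by
  obtain ⟨c, hc⟩ := exists_forall_norm_unitary_le n
  obtain ⟨C, hC⟩ := exists_forall_norm_comp_endDeriv_le hT hc h₁ ρ₀ (costCLM θ)
  refine ⟨C, fun H₀ h₀ u => ?_⟩
  rw [← (InnerProductSpace.toDual ℝ (Control T)).norm_map, toDual_flowField hT h₀ h₁]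
  exact hC H₀ h₀ u

theorem exists_lipschitzWith_flowField (hT : 0 ≤ T) (h₀ : H₀ ∈ skewAdjoint (Mat n))
    (h₁ : H₁ ∈ skewAdjoint (Mat n)) (ρ₀ θ : Mat n) :
    ∃ K, LipschitzWith K fun u : Control T => flowField H₀ H₁ ρ₀ θ u := by
  obtain ⟨c, hc⟩ := exists_forall_norm_unitary_le n
  obtain ⟨K, hK⟩ := exists_lipschitzWith_comp_endDeriv hT hc h₀ h₁ ρ₀ (costCLM θ)
  refine ⟨K, LipschitzWith.of_dist_le_mul fun u v => ?_⟩
  rw [← (InnerProductSpace.toDual ℝ (Control T)).dist_map, toDual_flowField hT h₀ h₁,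
    toDual_flowField hT h₀ h₁]
  exact hK.dist_le_mul u v

end Gradient

end QuantumControl

end

theorem mainTheorem6_general (n : ℕ) (T : ℝ) (hT : 0 ≤ T) (ρ₀ H₁ θ : Mat n)
    (h₁ : H₁ ∈ skewAdjoint (Mat n)) :
    ∃ C : ℝ, ∀ H₀ ∈ skewAdjoint (Mat n),
      (∀ u : Control T,
        (∃ ρ : ℝ → Mat n, IsTrajectory H₀ H₁ ρ₀ u ρ ∧
          ∀ ρ' : ℝ → Mat n, IsTrajectory H₀ H₁ ρ₀ u ρ' → EqOn ρ' ρ (Icc 0 T)) ∧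
        endPoint H₀ H₁ ρ₀ u ∈ unitaryOrbit ρ₀ ∧
        DifferentiableAt ℝ (fun w : Control T => endPoint H₀ H₁ ρ₀ w) u ∧
        (∀ v : Control T, dEnd H₀ H₁ ρ₀ u v ∈ tangentSpace (endPoint H₀ H₁ ρ₀ u)) ∧
        (∃! A, IsAdjoint H₀ H₁ ρ₀ u A) ∧
        (∃! ζ, IsGradJ θ (endPoint H₀ H₁ ρ₀ u) ζ) ∧
        HasGradientAt (fun w : Control T => costJ θ (endPoint H₀ H₁ ρ₀ w))
          (flowField H₀ H₁ ρ₀ θ u) u ∧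
        ‖flowField H₀ H₁ ρ₀ θ u‖ ≤ C) ∧
      ∀ u₀ : Control T, ∃ P : ℝ → Control T,
        IsFlowSolution H₀ H₁ ρ₀ θ u₀ (Ici 0) P ∧
        ∀ I : Set ℝ, I.OrdConnected → 0 ∈ I → I ⊆ Ici 0 →
          ∀ Q : ℝ → Control T, IsFlowSolution H₀ H₁ ρ₀ θ u₀ I Q → EqOn Q P I := by
  obtain ⟨C, hC⟩ := exists_forall_norm_flowField_le hT h₁ ρ₀ θ
  refine ⟨C, fun H₀ h₀ => ⟨fun u => ⟨exists_isTrajectory_forall_eqOn h₀ h₁ ρ₀ u,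
    endPoint_mem_unitaryOrbit hT h₀ h₁ ρ₀ u,
    (hasFDerivAt_endPoint hT h₀ h₁ ρ₀ u).differentiableAt,
    dEnd_mem_tangentSpace hT h₀ h₁ ρ₀ u,
    existsUnique_isAdjoint hT h₀ h₁ ρ₀ u,
    existsUnique_isGradJ θ _,
    hasGradientAt_flowField hT h₀ h₁ ρ₀ θ u,
    hC H₀ h₀ u⟩, fun u₀ => ?_⟩⟩
  obtain ⟨K, hK⟩ := exists_lipschitzWith_flowField hT h₀ h₁ ρ₀ θ
  exact exists_isIntegralCurveOn_Ici_forall_eqOn (hC H₀ h₀) hK u₀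

theorem mainTheorem6 (n : ℕ) (T : ℝ) (hT : 0 < T) (ρ₀ H₁ θ : Mat n)
    (hρ₀ : ρ₀.IsHermitian) (hH₁ : H₁ ∈ su n) (hθ : θ.IsHermitian) :
    ∃ C : ℝ, ∀ H₀ ∈ su n,
      -- every object in the equation is well defined, and the right-hand side is
      -- the gradient of `u ↦ J(End(u))`, bounded by `C`
      (∀ u : Control T,
        (∃ ρ : ℝ → Mat n, IsTrajectory H₀ H₁ ρ₀ u ρ ∧
          ∀ ρ' : ℝ → Mat n, IsTrajectory H₀ H₁ ρ₀ u ρ' → EqOn ρ' ρ (Icc 0 T)) ∧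
        endPoint H₀ H₁ ρ₀ u ∈ unitaryOrbit ρ₀ ∧
        DifferentiableAt ℝ (fun w : Control T => endPoint H₀ H₁ ρ₀ w) u ∧
        (∀ v : Control T, dEnd H₀ H₁ ρ₀ u v ∈ tangentSpace (endPoint H₀ H₁ ρ₀ u)) ∧
        (∃! A, IsAdjoint H₀ H₁ ρ₀ u A) ∧
        (∃! ζ, IsGradJ θ (endPoint H₀ H₁ ρ₀ u) ζ) ∧
        HasGradientAt (fun w : Control T => costJ θ (endPoint H₀ H₁ ρ₀ w))
          (flowField H₀ H₁ ρ₀ θ u) u ∧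
        ‖flowField H₀ H₁ ρ₀ θ u‖ ≤ C) ∧
      -- global existence and uniqueness
      ∀ u₀ : Control T, ∃ P : ℝ → Control T,
        IsFlowSolution H₀ H₁ ρ₀ θ u₀ (Ici 0) P ∧
        ∀ I : Set ℝ, I.OrdConnected → 0 ∈ I → I ⊆ Ici 0 →
          ∀ Q : ℝ → Control T, IsFlowSolution H₀ H₁ ρ₀ θ u₀ I Q → EqOn Q P I := by
  obtain ⟨C, hC⟩ := mainTheorem6_general n T hT.le ρ₀ H₁ θ hH₁.1
  exact ⟨C, fun H₀ h₀ => hC H₀ h₀.1⟩
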